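/- Let $X$ be a locally compact Hausdorff Abelian group (written multiplicatively), $\hat X$ its dual group of continuous characters $\xi:X\to\mathbb T$ (written additively, with the compact-open topology), and $\langle x,\xi\rangle=\xi(x)$. Assume that there is a jointly continuous map $(\cdot|\cdot):X\times\hat X\to\mathbb R$ which is a group homomorphism in each variable and satisfies $\langle x,\xi\rangle=e^{i(x|\xi)}$ for all $x\in X$, $\xi\in\hat X$, and fix such a map. Let $G=X\times\hat X$ be the product group, and let $\mathcal H=L^2(X)$ be the complex $L^2$-space with respect to a (regular) Haar measure of $X$. Define on $\mathcal H$ the operators $(U(x)\varphi)(y)=\varphi(x^{-1}y)$, $(V(\xi)\varphi)(y)=\langle y,\xi\rangle\varphi(y)$, and $$W(x,\xi)=e^{\frac i2(x|\xi)}\,U(x)V(\xi),\qquad (x,\xi)\in G.$$ A projective unitary representation of a group $K$ on a Hilbert space is a map $R$ from $K$ to the unitary operators with $R(e)=1$ and $R(gh)=m(g,h)R(g)R(h)$ for some $m:K\times K\to\mathbb T$ with $m(g,e)=m(e,g)=1$ and $m(g,h)m(gh,k)=m(g,hk)m(h,k)$. It is irreducible if the Hilbert space is non-zero and $\{0\}$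 and the whole space are its only closed subspaces invariant under all $R(g)$. An operator system is a linear space of bounded operators which contains the identity and is closed under adjoints. The ultraweak topology on the bounded operators is the coarsest topology for which all functionals $A\mapsto\sum_{n}\langle\varphi_n|A\psi_n\rangle$ with $\sum_n\|\varphi_n\|^2<\infty$ and $\sum_n\|\psi_n\|^2<\infty$ are continuous. Then: 1. $W$ (the Weyl representation) is an irreducible projective unitary representation of $G$ on $\mathcal H$, and the linear span of $\{W(g):g\in G\}$ is an operator system which is ultraweakly dense in $B(\mathcal H)$. 2. The map $(g,h)\mapsto W(g)\otimes W(h)$ is an irreducible projective unitary representation of $G\times G$ on the Hilbert space tensor product $\mathcal H\otimes\mathcal H$, and the linear span of $\{W(g)\otimes W(h):g,h\in G\}$ is an operator system which is ultraweakly dense in $B(\mathcal H\otimes\mathcal H)$. -/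

import Mathlib

open MeasureTheory TensorProduct
open scoped ENNReal InnerProductSpace

noncomputable section

namespace WeylIrr

/-! ### Operators on a complex Hilbert space -/

section Hilbert

variable {H : Type*} [NormedAddCommGroup H] [InnerProductSpace ℂ H]

/-- The functional `A ↦ ∑ₙ ⟪φₙ, A ψₙ⟫` on bounded operators. -/
def seqFunctional (φ ψ : ℕ → H) (A : H →L[ℂ] H) : ℂ := ∑' n, ⟪φ n, A (ψ n)⟫_ℂ

/-- The series defining `seqFunctional` converges absolutely for square-summable sequences. -/
theorem summable_seqFunctional {φ ψ : ℕ → H} (hφ : Summable fun n => ‖φ n‖ ^ 2)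
    (hψ : Summable fun n => ‖ψ n‖ ^ 2) (A : H →L[ℂ] H) :
    Summable fun n => ‖⟪φ n, A (ψ n)⟫_ℂ‖ := by
  refine Summable.of_nonneg_of_le (fun _ => norm_nonneg _) (fun n => ?_)
    ((hφ.add hψ).mul_left ‖A‖)
  have h1 : ‖⟪φ n, A (ψ n)⟫_ℂ‖ ≤ ‖φ n‖ * (‖A‖ * ‖ψ n‖) :=
    (norm_inner_le_norm _ _).trans (mul_le_mul_of_nonneg_left (A.le_opNorm _) (norm_nonneg _))
  have h2 : ‖φ n‖ * ‖ψ n‖ ≤ ‖φ n‖ ^ 2 + ‖ψ n‖ ^ 2 := by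
    nlinarith [sq_nonneg (‖φ n‖ - ‖ψ n‖), sq_nonneg ‖φ n‖, sq_nonneg ‖ψ n‖]
  calc ‖⟪φ n, A (ψ n)⟫_ℂ‖ ≤ ‖A‖ * (‖φ n‖ * ‖ψ n‖) := by linarith
    _ ≤ _ := mul_le_mul_of_nonneg_left h2 (norm_nonneg _)

/-- The ultraweak (σ-weak) topology on `B(H)`: the coarsest topology for which all functionals
`A ↦ ∑ₙ ⟪φₙ, A ψₙ⟫` with `∑ ‖φₙ‖² < ∞` and `∑ ‖ψₙ‖² < ∞` are continuous. These functionals are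
exactly the maps `A ↦ tr (T A)` with `T` of trace class. -/
@[reducible] def ultraweakTopology (H : Type*) [NormedAddCommGroup H] [InnerProductSpace ℂ H] :
    TopologicalSpace (H →L[ℂ] H) :=
  ⨅ (φ : ℕ → H) (ψ : ℕ → H) (_ : Summable fun n => ‖φ n‖ ^ 2)
    (_ : Summable fun n => ‖ψ n‖ ^ 2),
    TopologicalSpace.induced (seqFunctional φ ψ) inferInstance

/-- The linear space `S` of bounded operators is dense for the ultraweak topology. -/
def IsUltraweaklyDense (S : Submodule ℂ (H →L[ℂ] H)) : Prop :=
  @Dense (H →L[ℂ] H) (ultraweakTopology H) (S : Set (H →L[ℂ] H))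

/-- A (concrete) operator system: a self-adjoint linear space of operators containing the
identity. -/
structure IsOperatorSystem [CompleteSpace H] (S : Submodule ℂ (H →L[ℂ] H)) : Prop where
  one_mem : (1 : H →L[ℂ] H) ∈ S
  adjoint_mem : ∀ A ∈ S, ContinuousLinearMap.adjoint A ∈ S

/-- `U` is a projective unitary representation of the group `G` on `H` with multiplier `m`. -/
structure IsProjectiveUnitaryRep [CompleteSpace H] {G : Type*} [Group G]
    (U : G → H →L[ℂ] H) (m : G → G → Circle) : Prop where
  unitary : ∀ g, U g ∈ unitary (H →L[ℂ] H)
  map_one : U 1 = 1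
  map_mul : ∀ g h, U (g * h) = (m g h : ℂ) • (U g * U h)
  mult_one_right : ∀ g, m g 1 = 1
  mult_one_left : ∀ g, m 1 g = 1
  cocycle : ∀ g h k, m g h * m (g * h) k = m g (h * k) * m h k

/-- `U` is an irreducible projective unitary representation: `H ≠ 0`, and the only closed
subspaces invariant under all `U g` are `0` and `H`. -/
structure IsIrreducibleProjectiveRep [CompleteSpace H] {G : Type*} [Group G]
    (U : G → H →L[ℂ] H) : Prop where
  projective : ∃ m : G → G → Circle, IsProjectiveUnitaryRep U m
  nontrivial : Nontrivial H
  eq_bot_or_eq_top : ∀ K : Submodule ℂ H, IsClosed (K : Set H) →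
    (∀ g, ∀ v ∈ K, U g v ∈ K) → K = ⊥ ∨ K = ⊤

/-- The Hilbert space tensor product: the completion of the algebraic tensor product for the inner
product determined by `⟪a ⊗ b, c ⊗ d⟫ = ⟪a, c⟫ ⟪b, d⟫`. -/
abbrev HilbertTensor (H K : Type*) [NormedAddCommGroup H] [InnerProductSpace ℂ H]
    [NormedAddCommGroup K] [InnerProductSpace ℂ K] : Type _ :=
  UniformSpace.Completion (H ⊗[ℂ] K)

/-- The tensor product `A ⊗ B` of bounded operators, acting on the Hilbert space tensor
product. -/
def tensorOp {K : Type*} [NormedAddCommGroup K] [InnerProductSpace ℂ K]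
    (A : H →L[ℂ] H) (B : K →L[ℂ] K) : HilbertTensor H K →L[ℂ] HilbertTensor H K :=
  (TensorProduct.mapL A B).completion

theorem tensorOp_tmul {K : Type*} [NormedAddCommGroup K] [InnerProductSpace ℂ K]
    (A : H →L[ℂ] H) (B : K →L[ℂ] K) (a : H) (b : K) :
    tensorOp A B ((a ⊗ₜ[ℂ] b : H ⊗[ℂ] K) : HilbertTensor H K)
      = ((A a ⊗ₜ[ℂ] B b : H ⊗[ℂ] K) : HilbertTensor H K) := by
  simp [tensorOp]

end Hilbert

/-! ### Phase space and the Weyl representation -/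

section Phase

variable {X : Type*} [CommGroup X] [TopologicalSpace X]

/-- A jointly continuous real bicharacter `(x|ξ)` on `X × X̂` that is a logarithm of the dual
pairing: `⟨x, ξ⟩ = ξ x = exp (i (x|ξ))`. -/
structure LogPairing (X : Type*) [CommGroup X] [TopologicalSpace X] where
  toFun : X → PontryaginDual X → ℝ
  continuous_uncurry : Continuous fun p : X × PontryaginDual X => toFun p.1 p.2
  map_mul_left : ∀ x y ξ, toFun (x * y) ξ = toFun x ξ + toFun y ξ
  map_mul_right : ∀ x ξ υ, toFun x (ξ * υ) = toFun x ξ + toFun x υ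
  pairing_eq : ∀ x (ξ : PontryaginDual X), ξ x = Circle.exp (toFun x ξ)

variable [IsTopologicalGroup X] [MeasurableSpace X] [BorelSpace X]
  (μ : Measure X) [μ.IsHaarMeasure]

/-- Position translation `(U(x) φ)(y) = φ (x⁻¹ y)` on `L²(X)`. -/
def transOp (x : X) : Lp ℂ 2 μ →L[ℂ] Lp ℂ 2 μ :=
  (Lp.compMeasurePreservingₗᵢ ℂ (fun y => x⁻¹ * y)
    (measurePreserving_mul_left μ x⁻¹)).toContinuousLinearMap

theorem transOp_ae (x : X) (φ : Lp ℂ 2 μ) :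
    transOp μ x φ =ᵐ[μ] fun y => φ (x⁻¹ * y) :=
  Lp.coeFn_compMeasurePreserving φ (measurePreserving_mul_left μ x⁻¹)

theorem memLp_character_mul (ξ : PontryaginDual X) (φ : Lp ℂ 2 μ) :
    MemLp (fun x => (ξ x : ℂ) * φ x) 2 μ := by
  have hc : Continuous fun x => (ξ x : ℂ) := continuous_subtype_val.comp (map_continuous ξ)
  refine (Lp.memLp φ).of_le (hc.aestronglyMeasurable.mul (Lp.aestronglyMeasurable φ)) ?_
  exact Filter.Eventually.of_forall fun x => by
    rw [norm_mul, Circle.norm_coe, one_mul]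

/-- Momentum translation `(V(ξ) φ)(x) = ⟨x, ξ⟩ φ(x)` on `L²(X)`. -/
def modOp (ξ : PontryaginDual X) : Lp ℂ 2 μ →L[ℂ] Lp ℂ 2 μ :=
  LinearMap.mkContinuous
    { toFun := fun φ => (memLp_character_mul μ ξ φ).toLp _
      map_add' := fun φ ψ => by
        rw [← MemLp.toLp_add (memLp_character_mul μ ξ φ) (memLp_character_mul μ ξ ψ)]
        refine MemLp.toLp_congr _ _ ?_
        filter_upwards [Lp.coeFn_add φ ψ] with x hx
        rw [hx, Pi.add_apply, mul_add, Pi.add_apply]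
      map_smul' := fun c φ => by
        rw [RingHom.id_apply, ← MemLp.toLp_const_smul]
        refine MemLp.toLp_congr _ _ ?_
        filter_upwards [Lp.coeFn_smul c φ] with x hx
        rw [hx, Pi.smul_apply, Pi.smul_apply, smul_eq_mul, smul_eq_mul, mul_left_comm] }
    1 (fun φ => by
      rw [one_mul]
      refine Lp.norm_le_norm_of_ae_le ?_
      filter_upwards [(memLp_character_mul μ ξ φ).coeFn_toLp] with x hx
      simp only [LinearMap.coe_mk, AddHom.coe_mk]
      rw [hx, norm_mul, Circle.norm_coe, one_mul])

theorem modOp_ae (ξ : PontryaginDual X) (φ : Lp ℂ 2 μ) :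
    modOp μ ξ φ =ᵐ[μ] fun x => (ξ x : ℂ) * φ x :=
  (memLp_character_mul μ ξ φ).coeFn_toLp

/-- The Weyl representation `W(x, ξ) = exp ((i/2) (x|ξ)) U(x) V(ξ)` of the phase space
`G = X × X̂` on `L²(X)`. -/
def weyl (B : LogPairing X) (g : X × PontryaginDual X) : Lp ℂ 2 μ →L[ℂ] Lp ℂ 2 μ :=
  Complex.exp (Complex.I / 2 * (B.toFun g.1 g.2 : ℂ)) • (transOp μ g.1 ∘L modOp μ g.2)

/-- The map `(g, h) ↦ W(g) ⊗ W(h)` on `L²(X) ⊗ L²(X)`. -/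
def weylTensor (B : LogPairing X)
    (p : (X × PontryaginDual X) × (X × PontryaginDual X)) :
    HilbertTensor (Lp ℂ 2 μ) (Lp ℂ 2 μ) →L[ℂ] HilbertTensor (Lp ℂ 2 μ) (Lp ℂ 2 μ) :=
  tensorOp (weyl μ B p.1) (weyl μ B p.2)

end Phase

end WeylIrr

end

/-! Everything reduces to one claim: a closed subspace of `L²(X)` invariant under all translations
`U(x)` and modulations `V(ξ)` is trivial (`eq_bot_or_eq_top_of_transOp_modOp`). Since `W(x, 1) =
U(x)` and `W(1, ξ) = V(ξ)`, this gives irreducibility of `W`, and Schur's lemma then makes the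
commutant scalar.

For the claim, characters separate points, so by Stone–Weierstrass an invariant closed subspace `K`
is stable under multiplication by every bounded continuous function (`mulOp_mem_of_modOp`). It is
also stable under averages `∫ f(x) U(x) dx`. Multiplying such an average by `l` on the left and `k`
on the right gives the integral kernel `l(y) f(y/z) k(z)`. If `f = 1` on the relevant quotients,
this is a rank-one operator (`mulOp_avgOp_mulOp`). Such operators send a nonzero vector of `K`, for
suitable `k`, to a nonzero multiple of an arbitrary `l` in `C_c(X)`, and these `l` are dense.

Separation of points (`exists_pontryaginDual_apply_ne_one`) comes from Gelfand theory: a character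
of a commutative C⋆-algebra of operators containing all translations restricts to a homomorphism on
`X`. Including one averaged translation in the algebra forces continuity.

Density is von Neumann's bicommutant argument on `ℓ²(ι, H)`: the span of a projective representation
is a unital self-adjoint algebra (`isUltraweaklyDense_of_commutant`). For the tensor product,
slicing shows that an operator commuting with both factors is scalar (`tensor_commutant`), and the
same general machinery applies. -/

noncomputable section

namespace WeylIrr

/-! ### Schur's lemma and its converse. -/

section Commutant

variable {H : Type*} [NormedAddCommGroup H] [InnerProductSpace ℂ H] [CompleteSpace H]

/-- A closed subspace invariant under an operator and its adjoint has a projection commuting with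
that operator. -/
theorem starProjection_commute (K : Submodule ℂ H) [K.HasOrthogonalProjection] (A : H →L[ℂ] H)
    (hA : ∀ v ∈ K, A v ∈ K) (hA' : ∀ v ∈ K, ContinuousLinearMap.adjoint A v ∈ K) (v : H) :
    K.starProjection (A v) = A (K.starProjection v) := by
  refine Submodule.eq_starProjection_of_mem_orthogonal
    (hA _ (K.starProjection_apply_mem v)) ?_
  rw [← map_sub, Submodule.mem_orthogonal]
  intro u hu
  rw [← ContinuousLinearMap.adjoint_inner_left]
  exact (Submodule.mem_orthogonal _ _).1 (K.sub_starProjection_mem_orthogonal v) _ (hA' u hu)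

/-- If the spectrum had two points, two continuous functions `f`, `g` with `g f = 0` could be chosen
with neither vanishing on it. The kernel of `g(T)` is then invariant under `S`, contains the nonzero
range of `f(T)`, and is not the whole space. -/
theorem exists_smul_one_of_isSelfAdjoint (S : Set (H →L[ℂ] H))
    (hirr : ∀ K : Submodule ℂ H, IsClosed (K : Set H) →
      (∀ A ∈ S, ∀ v ∈ K, A v ∈ K) → K = ⊥ ∨ K = ⊤)
    (T : H →L[ℂ] H) (hT : IsSelfAdjoint T) (hcomm : ∀ A ∈ S, T * A = A * T) :
    ∃ c : ℂ, T = c • 1 := by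
  rcases subsingleton_or_nontrivial H with _ | _
  · exact ⟨0, Subsingleton.elim _ _⟩
  by_cases hsub : (spectrum ℝ T).Subsingleton
  · obtain ⟨r, hr⟩ : ∃ r : ℝ, spectrum ℝ T ⊆ {r} := by
      rcases hsub.eq_empty_or_singleton with h | ⟨r, h⟩
      · exact ⟨0, by simp [h]⟩
      · exact ⟨r, h.subset⟩
    refine ⟨r, ?_⟩
    have := CFC.eq_algebraMap_of_spectrum_subset_singleton (R := ℝ) T r hr
    rw [this, Algebra.algebraMap_eq_smul_one]
    ext v
    simp
  exfalso
  obtain ⟨a, ha, b, hb, hab⟩ : ∃ a ∈ spectrum ℝ T, ∃ b ∈ spectrum ℝ T, a < b := by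
    rw [Set.not_subsingleton_iff] at hsub
    exact hsub.exists_lt
  -- Spectral mapping: `f t` lies in the spectrum of `f(T)`, which would be `{0}` if `f(T) = 0`.
  have hne : ∀ f : ℝ → ℝ, Continuous f → ∀ t ∈ spectrum ℝ T, f t ≠ 0 → cfc f T ≠ 0 := by
    intro f hf t ht hft h0
    have h1 := cfc_map_spectrum f T hT hf.continuousOn
    rw [h0, spectrum.zero_eq] at h1
    exact hft (h1.symm.subset (Set.mem_image_of_mem f ht))
  let m := (a + b) / 2
  let f : ℝ → ℝ := fun t => max 0 (m - t)
  let g : ℝ → ℝ := fun t => max 0 (t - m)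
  have hf : Continuous f := by fun_prop
  have hg : Continuous g := by fun_prop
  have hf0 := hne f hf a ha (by simp only [f, m]; rw [max_eq_right] <;> linarith)
  have hg0 := hne g hg b hb (by simp only [g, m]; rw [max_eq_right] <;> linarith)
  have hfg : cfc g T * cfc f T = 0 := by
    rw [← cfc_mul g f T hg.continuousOn hf.continuousOn]
    have : (fun t => g t * f t) = fun _ => 0 := by
      ext t
      simp only [f, g]
      rcases le_total t m with h | h
      · rw [max_eq_left (a := (0 : ℝ)) (b := t - m) (by linarith), zero_mul]
      · rw [max_eq_left (a := (0 : ℝ)) (b := m - t) (by linarith), mul_zero]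
    rw [this, cfc_const_zero]
  have hgA : ∀ A ∈ S, cfc g T * A = A * cfc g T := fun A hA =>
    (Commute.cfc_real (show Commute T A from hcomm A hA) g).eq
  have hK := hirr (LinearMap.ker (cfc g T : H →L[ℂ] H).toLinearMap)
    (ContinuousLinearMap.isClosed_ker (cfc g T : H →L[ℂ] H)) (by
      intro A hA v hv
      have h2 := congrArg (fun L : H →L[ℂ] H => L v) (hgA A hA)
      simp only [mul_apply_eq_comp] at h2
      simp only [LinearMap.mem_ker, ContinuousLinearMap.coe_coe] at hv ⊢
      rw [h2, hv, map_zero])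
  rcases hK with hK | hK
  · apply hf0
    ext v
    have : (cfc f T : H →L[ℂ] H) v ∈ LinearMap.ker (cfc g T : H →L[ℂ] H).toLinearMap := by
      simp only [LinearMap.mem_ker, ContinuousLinearMap.coe_coe]
      rw [← mul_apply_eq_comp, hfg, zero_apply]
    rw [hK] at this
    simpa using this
  · apply hg0
    ext v
    have : v ∈ LinearMap.ker (cfc g T : H →L[ℂ] H).toLinearMap := hK ▸ Submodule.mem_top
    simpa using this

/-- Schur's lemma: the commutant of an irreducible self-adjoint set of operators is trivial. -/
theorem exists_smul_one_of_commute (S : Set (H →L[ℂ] H))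
    (hstar : ∀ A ∈ S, ContinuousLinearMap.adjoint A ∈ S)
    (hirr : ∀ K : Submodule ℂ H, IsClosed (K : Set H) →
      (∀ A ∈ S, ∀ v ∈ K, A v ∈ K) → K = ⊥ ∨ K = ⊤)
    (T : H →L[ℂ] H) (hcomm : ∀ A ∈ S, T * A = A * T) :
    ∃ c : ℂ, T = c • 1 := by
  -- As `S` is self-adjoint, its commutant is too; hence the self-adjoint case applies to the real
  -- and imaginary parts of `T`.
  have hcomm' : ∀ A ∈ S, star T * A = A * star T := fun A hA => by
    have := congrArg star (hcomm _ (hstar A hA))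
    rw [star_mul, star_mul, ← ContinuousLinearMap.star_eq_adjoint, star_star] at this
    exact this.symm
  have hre : ∀ A ∈ S, (realPart T : H →L[ℂ] H) * A = A * (realPart T : H →L[ℂ] H) := by
    intro A hA
    rw [realPart_apply_coe, smul_mul_assoc, mul_smul_comm, add_mul, mul_add, hcomm A hA,
      hcomm' A hA]
  have him : ∀ A ∈ S, (imaginaryPart T : H →L[ℂ] H) * A = A * (imaginaryPart T : H →L[ℂ] H) := by
    intro A hA
    rw [imaginaryPart_apply_coe, smul_mul_assoc, mul_smul_comm, smul_mul_assoc, mul_smul_comm,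
      sub_mul, mul_sub, hcomm A hA, hcomm' A hA]
  obtain ⟨c, hc⟩ := exists_smul_one_of_isSelfAdjoint S hirr _ (realPart T).2 hre
  obtain ⟨d, hd⟩ := exists_smul_one_of_isSelfAdjoint S hirr _ (imaginaryPart T).2 him
  refine ⟨c + Complex.I * d, ?_⟩
  rw [← realPart_add_I_smul_imaginaryPart T, hc, hd, smul_smul, add_smul]

/-- A self-adjoint set of operators with trivial commutant is irreducible. -/
theorem eq_bot_or_eq_top_of_commutant (S : Set (H →L[ℂ] H))
    (hstar : ∀ A ∈ S, ContinuousLinearMap.adjoint A ∈ S)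
    (hcomm : ∀ T : H →L[ℂ] H, (∀ A ∈ S, T * A = A * T) → ∃ c : ℂ, T = c • 1)
    (K : Submodule ℂ H) (hK : IsClosed (K : Set H)) (hinv : ∀ A ∈ S, ∀ v ∈ K, A v ∈ K) :
    K = ⊥ ∨ K = ⊤ := by
  have : CompleteSpace K := hK.completeSpace_coe
  obtain ⟨c, hc⟩ := hcomm K.starProjection fun A hA => by
    ext v
    exact starProjection_commute K A (hinv A hA) (hinv _ (hstar A hA)) v
  rcases eq_or_ne c 0 with rfl | hc0
  · left
    rw [Submodule.eq_bot_iff]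
    intro v hv
    rw [← Submodule.starProjection_eq_self_iff.2 hv, hc]
    simp
  · right
    rw [Submodule.eq_top_iff']
    intro v
    have h := K.starProjection_apply_mem v
    rw [hc] at h
    have h2 := K.smul_mem c⁻¹ h
    simpa [smul_smul, inv_mul_cancel₀ hc0] using h2

end Commutant

/-! ### The bicommutant argument for ultraweak density. -/

section Bicommutant

variable {H : Type*} [NormedAddCommGroup H] [InnerProductSpace ℂ H]

/-- The diagonal action of an operator on `ℓ²(ι, H)`. -/
def ampl (ι : Type*) (A : H →L[ℂ] H) :
    lp (fun _ : ι => H) 2 →L[ℂ] lp (fun _ : ι => H) 2 :=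
  lp.mapCLM 2 (fun _ => A) (norm_nonneg A) fun _ => le_rfl

@[simp]
theorem ampl_apply (ι : Type*) (A : H →L[ℂ] H) (f : lp (fun _ : ι => H) 2) (i : ι) :
    ampl ι A f i = A (f i) := rfl

theorem ampl_single {ι : Type*} [DecidableEq ι] (A : H →L[ℂ] H) (j : ι) (v : H) :
    ampl ι A (lp.single 2 j v) = lp.single 2 j (A v) := by
  ext i
  rw [ampl_apply, lp.coeFn_single, lp.coeFn_single]
  by_cases h : i = j
  · subst h; simp
  · simp [h]

variable [CompleteSpace H]

theorem adjoint_ampl (ι : Type*) (A : H →L[ℂ] H) :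
    ContinuousLinearMap.adjoint (ampl ι A) = ampl ι (ContinuousLinearMap.adjoint A) := by
  symm
  rw [ContinuousLinearMap.eq_adjoint_iff]
  intro f g
  rw [lp.inner_eq_tsum, lp.inner_eq_tsum]
  simp only [ampl_apply, ContinuousLinearMap.adjoint_inner_left]

/-- The projection `P` onto the closure of `SΨ` commutes with the amplified `S`, so each matrix
entry of `P` commutes with `S` and is a scalar. A matrix of scalars commutes with every amplified
`A`. Since `1 ∈ S` puts `Ψ` in the range of `P`, the range also contains `AΨ`. -/
theorem ampl_mem_closure (S : Submodule ℂ (H →L[ℂ] H)) (h1 : 1 ∈ S)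
    (hmul : ∀ A ∈ S, ∀ B ∈ S, A * B ∈ S) (hstar : ∀ A ∈ S, ContinuousLinearMap.adjoint A ∈ S)
    (hcomm : ∀ T : H →L[ℂ] H, (∀ A ∈ S, T * A = A * T) → ∃ c : ℂ, T = c • 1)
    {ι : Type*} (Ψ : lp (fun _ : ι => H) 2) (A : H →L[ℂ] H) :
    ampl ι A Ψ ∈ closure {x | ∃ B ∈ S, ampl ι B Ψ = x} := by
  classical
  let ev : (H →L[ℂ] H) →ₗ[ℂ] lp (fun _ : ι => H) 2 :=
    { toFun := fun B => ampl ι B Ψ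
      map_add' := fun B C => by ext i; simp
      map_smul' := fun c B => by ext i; simp }
  let K := (S.map ev).topologicalClosure
  have hKc : IsClosed (K : Set (lp (fun _ : ι => H) 2)) := Submodule.isClosed_topologicalClosure _
  have : CompleteSpace K := hKc.completeSpace_coe
  have hinv : ∀ B ∈ S, ∀ v ∈ K, ampl ι B v ∈ K := by
    intro B hB v hv
    refine map_mem_closure (ampl ι B).continuous hv ?_
    rintro _ ⟨C, hC, rfl⟩
    exact ⟨B * C, hmul B hB C hC, by ext i; simp [ev]⟩
  have hP : ∀ B ∈ S, ∀ v, K.starProjection (ampl ι B v) = ampl ι B (K.starProjection v) :=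
    fun B hB v => starProjection_commute K _ (hinv B hB)
      (by rw [adjoint_ampl]; exact hinv _ (hstar B hB)) v
  have hc : ∀ i j : ι, ∃ c : ℂ, ∀ v, K.starProjection (lp.single 2 j v) i = c • v := by
    intro i j
    -- The `(i, j)` matrix entry of the projection.
    let Q : H →L[ℂ] H := LinearMap.mkContinuous
      { toFun := fun v => K.starProjection (lp.single 2 j v) i
        map_add' := fun v w => by rw [lp.single_add, map_add]; rfl
        map_smul' := fun c v => by rw [lp.single_smul, map_smul]; rfl } 1 (fun v => by
          rw [one_mul]
          refine (lp.norm_apply_le_norm (by norm_num) _ i).trans ?_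
          refine (K.norm_starProjection_apply_le _).trans ?_
          rw [lp.norm_single (by norm_num)])
    obtain ⟨c, hc⟩ := hcomm Q fun B hB => by
      ext v
      change K.starProjection (lp.single 2 j (B v)) i = B (K.starProjection (lp.single 2 j v) i)
      rw [← ampl_single, hP B hB]
      rfl
    exact ⟨c, fun v => congrArg (fun L : H →L[ℂ] H => L v) hc⟩
  have hPA : K.starProjection * ampl ι A = ampl ι A * K.starProjection := by
    ext1 Φ
    have hs := lp.hasSum_single (E := fun _ : ι => H) (p := 2) (by norm_num) Φ
    refine (hs.mapL (K.starProjection * ampl ι A)).unique ?_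
    convert! hs.mapL (ampl ι A * K.starProjection) using 2 with j
    ext i
    obtain ⟨c, hc⟩ := hc i j
    rw [mul_apply_eq_comp, mul_apply_eq_comp, ampl_single, hc, ampl_apply,
      hc, map_smul]
  have hΨ : Ψ ∈ K := subset_closure ⟨1, h1, by ext i; simp [ev]⟩
  have h := congrArg (fun L : lp (fun _ : ι => H) 2 →L[ℂ] lp (fun _ : ι => H) 2 => L Ψ) hPA
  simp only [mul_apply_eq_comp] at h
  rw [Submodule.starProjection_eq_self_iff.2 hΨ] at h
  have h2 : ampl ι A Ψ ∈ K := Submodule.starProjection_eq_self_iff.1 h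
  exact h2

/-- Finitely many functionals are handled by a single vector: all sequences `ψ k` are gathered into
one `Ψ` in `ℓ²(κ × ℕ, H)`, which is square-summable because `κ` is finite. Each functional then
becomes an inner product with the amplified operator applied to `Ψ`. -/
theorem seqFunctional_mem_closure (S : Submodule ℂ (H →L[ℂ] H)) (h1 : 1 ∈ S)
    (hmul : ∀ A ∈ S, ∀ B ∈ S, A * B ∈ S) (hstar : ∀ A ∈ S, ContinuousLinearMap.adjoint A ∈ S)
    (hcomm : ∀ T : H →L[ℂ] H, (∀ A ∈ S, T * A = A * T) → ∃ c : ℂ, T = c • 1)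
    {κ : Type*} [Finite κ] {φ ψ : κ → ℕ → H} (hφ : ∀ k, Summable fun n => ‖φ k n‖ ^ 2)
    (hψ : ∀ k, Summable fun n => ‖ψ k n‖ ^ 2) (A : H →L[ℂ] H) :
    (fun k => seqFunctional (φ k) (ψ k) A) ∈
      closure ((fun B k => seqFunctional (φ k) (ψ k) B) '' (S : Set (H →L[ℂ] H))) := by
  classical
  have hmem : ∀ χ : κ → ℕ → H, (∀ k, Summable fun n => ‖χ k n‖ ^ 2) →
      Memℓp (fun p : κ × ℕ => χ p.1 p.2) 2 := by
    intro χ hχ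
    rw [memℓp_gen_iff (by norm_num)]
    simp only [ENNReal.toReal_ofNat, Real.rpow_ofNat]
    rw [summable_prod_of_nonneg (fun _ => by positivity)]
    exact ⟨hχ, Summable.of_finite⟩
  let Ψ : lp (fun _ : κ × ℕ => H) 2 := ⟨_, hmem ψ hψ⟩
  -- `Φ k` is supported on the slice `{k} × ℕ`, so pairing with it picks out only the terms of the
  -- `k`-th functional.
  let Φ : κ → lp (fun _ : κ × ℕ => H) 2 := fun k =>
    ⟨_, hmem (fun l => if l = k then φ k else 0) fun l => by
      by_cases h : l = k
      · simpa [h] using hφ k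
      · simp [h, summable_zero]⟩
  have key : ∀ B k, seqFunctional (φ k) (ψ k) B = ⟪Φ k, ampl (κ × ℕ) B Ψ⟫_ℂ := by
    intro B k
    rw [lp.inner_eq_tsum, seqFunctional]
    rw [← (Prod.mk_right_injective k).tsum_eq]
    · simp [Φ, Ψ]
    · rintro ⟨l, n⟩ hln
      by_cases h : l = k
      · exact ⟨n, by rw [h]⟩
      · simp [Φ, h] at hln
  let L : lp (fun _ : κ × ℕ => H) 2 → κ → ℂ := fun x k => ⟪Φ k, x⟫_ℂ
  have hL : Continuous L := by fun_prop
  have hA : (fun k => seqFunctional (φ k) (ψ k) A) = L (ampl (κ × ℕ) A Ψ) := by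
    ext k; exact key A k
  rw [hA]
  refine map_mem_closure hL (ampl_mem_closure S h1 hmul hstar hcomm Ψ A) ?_
  rintro _ ⟨B, hB, rfl⟩
  exact ⟨B, hB, by ext k; exact key B k⟩

-- A single map into a product makes basic neighbourhoods involve only finitely many functionals.
omit [CompleteSpace H] in
theorem ultraweakTopology_eq_induced :
    ultraweakTopology H = TopologicalSpace.induced
      (fun (A : H →L[ℂ] H)
        (p : {p : (ℕ → H) × (ℕ → H) // (Summable fun n => ‖p.1 n‖ ^ 2) ∧
          Summable fun n => ‖p.2 n‖ ^ 2}) => seqFunctional p.1.1 p.1.2 A)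
      Pi.topologicalSpace := by
  rw [induced_to_pi]
  refine le_antisymm (le_iInf fun p => ?_) ?_
  · exact (iInf_le_of_le p.1.1 <| iInf_le_of_le p.1.2 <| iInf_le_of_le p.2.1 <|
      iInf_le_of_le p.2.2 le_rfl)
  · exact le_iInf fun φ => le_iInf fun ψ => le_iInf fun hφ => le_iInf fun hψ =>
      iInf_le_of_le ⟨(φ, ψ), hφ, hψ⟩ le_rfl

/-- A unital self-adjoint algebra of operators with trivial commutant is ultraweakly dense. -/
theorem isUltraweaklyDense_of_commutant (S : Submodule ℂ (H →L[ℂ] H)) (h1 : 1 ∈ S)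
    (hmul : ∀ A ∈ S, ∀ B ∈ S, A * B ∈ S) (hstar : ∀ A ∈ S, ContinuousLinearMap.adjoint A ∈ S)
    (hcomm : ∀ T : H →L[ℂ] H, (∀ A ∈ S, T * A = A * T) → ∃ c : ℂ, T = c • 1) :
    IsUltraweaklyDense S := by
  intro A
  rw [ultraweakTopology_eq_induced, closure_induced, mem_closure_iff]
  intro o ho hAo
  obtain ⟨J, u, hu, hJ⟩ := isOpen_pi_iff.1 ho _ hAo
  have hcl := seqFunctional_mem_closure S h1 hmul hstar hcomm
    (φ := fun k : J => k.1.1.1) (ψ := fun k : J => k.1.1.2)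
    (fun k => k.1.2.1) (fun k => k.1.2.2) A
  obtain ⟨_, hg, B, hB, rfl⟩ := mem_closure_iff.1 hcl
    (Set.univ.pi fun k : J => u k)
    (isOpen_set_pi Set.finite_univ fun k _ => (hu k k.2).1) (fun k _ => (hu k k.2).2)
  exact ⟨_, hJ fun k hk => hg ⟨k, hk⟩ trivial, B, hB, rfl⟩

end Bicommutant


/-! ### The operator algebra spanned by a projective representation. -/

section ProjectiveRep

variable {H : Type*} [NormedAddCommGroup H] [InnerProductSpace ℂ H] [CompleteSpace H]
  {G : Type*} [Group G] {U : G → H →L[ℂ] H} {m : G → G → Circle}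

namespace IsProjectiveUnitaryRep

/-- The right-hand side is a right inverse of the unitary `U g`, hence its adjoint. -/
theorem adjoint_eq (hU : IsProjectiveUnitaryRep U m) (g : G) :
    ContinuousLinearMap.adjoint (U g) = (m g g⁻¹ : ℂ) • U g⁻¹ := by
  have h1 : U g * ((m g g⁻¹ : ℂ) • U g⁻¹) = 1 := by
    rw [mul_smul_comm, ← hU.map_mul, mul_inv_cancel, hU.map_one]
  have h2 : ContinuousLinearMap.adjoint (U g) * U g = 1 := (Unitary.mem_iff.1 (hU.unitary g)).1
  calc ContinuousLinearMap.adjoint (U g)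
      = ContinuousLinearMap.adjoint (U g) * (U g * ((m g g⁻¹ : ℂ) • U g⁻¹)) := by rw [h1, mul_one]
    _ = _ := by rw [← mul_assoc, h2, one_mul]

theorem mul_eq (hU : IsProjectiveUnitaryRep U m) (g h : G) :
    U g * U h = ((m g h)⁻¹ : Circle) • U (g * h) := by
  rw [hU.map_mul, Circle.smul_def, smul_smul, ← Circle.coe_mul, inv_mul_cancel, Circle.coe_one,
    one_smul]

theorem one_mem_span (hU : IsProjectiveUnitaryRep U m) :
    1 ∈ Submodule.span ℂ (Set.range U) :=
  Submodule.subset_span ⟨1, hU.map_one⟩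

theorem mul_mem_span (hU : IsProjectiveUnitaryRep U m) :
    ∀ A ∈ Submodule.span ℂ (Set.range U), ∀ B ∈ Submodule.span ℂ (Set.range U),
      A * B ∈ Submodule.span ℂ (Set.range U) := by
  intro A hA B hB
  have h := Submodule.mul_mem_mul hA hB
  rw [Submodule.span_mul_span] at h
  refine Submodule.span_le.2 ?_ h
  rintro _ ⟨_, ⟨g, rfl⟩, _, ⟨k, rfl⟩, rfl⟩
  simp only [SetLike.mem_coe]
  rw [hU.mul_eq, Circle.smul_def]
  exact Submodule.smul_mem _ _ (Submodule.subset_span ⟨_, rfl⟩)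

theorem adjoint_mem_span (hU : IsProjectiveUnitaryRep U m) :
    ∀ A ∈ Submodule.span ℂ (Set.range U),
      ContinuousLinearMap.adjoint A ∈ Submodule.span ℂ (Set.range U) := by
  intro A hA
  induction hA using Submodule.span_induction with
  | mem A hA =>
    obtain ⟨g, rfl⟩ := hA
    rw [hU.adjoint_eq]
    exact Submodule.smul_mem _ _ (Submodule.subset_span ⟨_, rfl⟩)
  | zero => rw [map_zero]; exact Submodule.zero_mem _
  | add A B _ _ hA hB => rw [map_add]; exact Submodule.add_mem _ hA hB
  | smul c A _ hA =>
    rw [LinearIsometryEquiv.map_smulₛₗ]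
    exact Submodule.smul_mem _ _ hA

/-- The commutant of an irreducible projective representation is trivial. -/
theorem exists_smul_one_of_commute (hU : IsProjectiveUnitaryRep U m)
    (hirr : ∀ K : Submodule ℂ H, IsClosed (K : Set H) →
      (∀ g, ∀ v ∈ K, U g v ∈ K) → K = ⊥ ∨ K = ⊤)
    (T : H →L[ℂ] H) (hT : ∀ g, T * U g = U g * T) : ∃ c : ℂ, T = c • 1 := by
  refine WeylIrr.exists_smul_one_of_commute (Submodule.span ℂ (Set.range U) : Set _)
    hU.adjoint_mem_span
    (fun K hK hinv => hirr K hK fun g =>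
      hinv (U g) (Submodule.subset_span (Set.mem_range_self g))) T ?_
  intro A hA
  induction hA using Submodule.span_induction with
  | mem A hA => obtain ⟨g, rfl⟩ := hA; exact hT g
  | zero => rw [zero_mul, mul_zero]
  | add A B _ _ hA hB => rw [add_mul, mul_add, hA, hB]
  | smul c A _ hA => rw [smul_mul_assoc, mul_smul_comm, hA]

/-- A projective unitary representation with trivial commutant is irreducible, and its linear span
is an ultraweakly dense operator system. -/
theorem irreducible_and_dense [Nontrivial H] (hU : IsProjectiveUnitaryRep U m)
    (hcomm : ∀ T : H →L[ℂ] H, (∀ g, T * U g = U g * T) → ∃ c : ℂ, T = c • 1) :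
    IsIrreducibleProjectiveRep U ∧ IsOperatorSystem (Submodule.span ℂ (Set.range U)) ∧
      IsUltraweaklyDense (Submodule.span ℂ (Set.range U)) := by
  have hcomm' : ∀ T : H →L[ℂ] H, (∀ A ∈ Submodule.span ℂ (Set.range U), T * A = A * T) →
      ∃ c : ℂ, T = c • 1 :=
    fun T hT => hcomm T fun g => hT _ (Submodule.subset_span ⟨g, rfl⟩)
  refine ⟨⟨⟨m, hU⟩, inferInstance, fun K hK hinv => ?_⟩, ⟨hU.one_mem_span, hU.adjoint_mem_span⟩,
    isUltraweaklyDense_of_commutant _ hU.one_mem_span hU.mul_mem_span hU.adjoint_mem_span hcomm'⟩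
  refine eq_bot_or_eq_top_of_commutant (Submodule.span ℂ (Set.range U) : Set _)
    hU.adjoint_mem_span hcomm' K hK fun A hA v hv => ?_
  induction hA using Submodule.span_induction with
  | mem A hA => obtain ⟨g, rfl⟩ := hA; exact hinv g v hv
  | zero => exact K.zero_mem
  | add A B _ _ hA hB => exact K.add_mem hA hB
  | smul c A _ hA => exact K.smul_mem c hA

end IsProjectiveUnitaryRep

end ProjectiveRep

/-! ### Hilbert space tensor products and their commutants. -/

section Tensor

variable {H K : Type*} [NormedAddCommGroup H] [InnerProductSpace ℂ H]
  [NormedAddCommGroup K] [InnerProductSpace ℂ K]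

/-- The elementary tensor `a ⊗ b` in the Hilbert space tensor product. -/
def elemTensor (a : H) (b : K) : HilbertTensor H K := ((a ⊗ₜ[ℂ] b : H ⊗[ℂ] K) : HilbertTensor H K)

theorem inner_elemTensor (a a' : H) (b b' : K) :
    ⟪elemTensor a b, elemTensor a' b'⟫_ℂ = ⟪a, a'⟫_ℂ * ⟪b, b'⟫_ℂ := by
  rw [elemTensor, elemTensor, UniformSpace.Completion.inner_coe, TensorProduct.inner_tmul]

theorem norm_elemTensor (a : H) (b : K) : ‖elemTensor a b‖ = ‖a‖ * ‖b‖ := by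
  rw [elemTensor, UniformSpace.Completion.norm_coe, TensorProduct.norm_tmul]

theorem ext_elemTensor {E : Type*} [NormedAddCommGroup E] [NormedSpace ℂ E]
    {S T : HilbertTensor H K →L[ℂ] E}
    (h : ∀ a b, S (elemTensor a b) = T (elemTensor a b)) : S = T := by
  ext x
  induction x using UniformSpace.Completion.induction_on with
  | hp => exact isClosed_eq S.continuous T.continuous
  | ih x =>
    induction x using TensorProduct.induction_on with
    | zero => rw [UniformSpace.Completion.coe_zero, map_zero, map_zero]
    | tmul a b => exact h a b
    | add x y hx hy => rw [UniformSpace.Completion.coe_add, map_add, map_add, hx, hy]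

theorem eq_of_inner_elemTensor {x y : HilbertTensor H K}
    (h : ∀ a b, ⟪elemTensor a b, x⟫_ℂ = ⟪elemTensor a b, y⟫_ℂ) : x = y := by
  have : innerSL ℂ x = innerSL ℂ y := ext_elemTensor fun a b => by
    simp only [innerSL_apply_apply]
    rw [← inner_conj_symm, h, inner_conj_symm]
  exact ext_inner_right ℂ fun v => congrArg (fun L : HilbertTensor H K →L[ℂ] ℂ => L v) this

theorem tensorOp_elemTensor (A : H →L[ℂ] H) (B : K →L[ℂ] K) (a : H) (b : K) :
    tensorOp A B (elemTensor a b) = elemTensor (A a) (B b) := tensorOp_tmul A B a b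

theorem tensorOp_mul (A A' : H →L[ℂ] H) (B B' : K →L[ℂ] K) :
    tensorOp A B * tensorOp A' B' = tensorOp (A * A') (B * B') :=
  ext_elemTensor fun a b => by simp only [mul_apply_eq_comp, tensorOp_elemTensor]

theorem tensorOp_one : tensorOp (1 : H →L[ℂ] H) (1 : K →L[ℂ] K) = 1 :=
  ext_elemTensor fun a b => by simp only [one_apply_eq_self, tensorOp_elemTensor]

theorem elemTensor_smul_smul (c d : ℂ) (a : H) (b : K) :
    elemTensor (c • a) (d • b) = (c * d) • elemTensor a b := by
  rw [elemTensor, TensorProduct.smul_tmul_smul, UniformSpace.Completion.coe_smul]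
  rfl

theorem tensorOp_smul_smul (c d : ℂ) (A : H →L[ℂ] H) (B : K →L[ℂ] K) :
    tensorOp (c • A) (d • B) = (c * d) • tensorOp A B :=
  ext_elemTensor fun a b => by
    rw [tensorOp_elemTensor, smul_apply, smul_apply, smul_apply, elemTensor_smul_smul,
      tensorOp_elemTensor]

/-- Insertion `a ↦ a ⊗ b` of a vector into the second tensor factor. -/
def tensorRight (b : K) : H →L[ℂ] HilbertTensor H K :=
  LinearMap.mkContinuous
    { toFun := fun a => elemTensor a b
      map_add' := fun a a' => by
        simp only [elemTensor]
        rw [TensorProduct.add_tmul, UniformSpace.Completion.coe_add]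
      map_smul' := fun c a => by simpa using elemTensor_smul_smul c 1 a b } ‖b‖
    fun a => by simp [norm_elemTensor, mul_comm]

/-- Insertion `b ↦ a ⊗ b` of a vector into the first tensor factor. -/
def tensorLeft (a : H) : K →L[ℂ] HilbertTensor H K :=
  LinearMap.mkContinuous
    { toFun := fun b => elemTensor a b
      map_add' := fun b b' => by
        simp only [elemTensor]
        rw [TensorProduct.tmul_add, UniformSpace.Completion.coe_add]
      map_smul' := fun c b => by simpa using elemTensor_smul_smul 1 c a b } ‖a‖
    fun b => by simp [norm_elemTensor]

variable [CompleteSpace H] [CompleteSpace K]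

theorem adjoint_tensorOp (A : H →L[ℂ] H) (B : K →L[ℂ] K) :
    ContinuousLinearMap.adjoint (tensorOp A B) =
      tensorOp (ContinuousLinearMap.adjoint A) (ContinuousLinearMap.adjoint B) :=
  ext_elemTensor fun a b => eq_of_inner_elemTensor fun a' b' => by
    rw [ContinuousLinearMap.adjoint_inner_right, tensorOp_elemTensor, tensorOp_elemTensor,
      inner_elemTensor, inner_elemTensor, ContinuousLinearMap.adjoint_inner_right,
      ContinuousLinearMap.adjoint_inner_right]

/-- If the operators `U i` have trivial commutant, the slice `J† T J'` of an operator `T` by maps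
intertwining `U` with operators commuting with `T` is a scalar. -/
theorem slice_eq_smul_inner {E : Type*} [NormedAddCommGroup E] [InnerProductSpace ℂ E]
    [CompleteSpace E] {ι : Type*} {U : ι → H →L[ℂ] H}
    (hU : ∀ T : H →L[ℂ] H, (∀ i, T * U i = U i * T) → ∃ c : ℂ, T = c • 1)
    (W : ι → E →L[ℂ] E) (T : E →L[ℂ] E) (hT : ∀ i, T * W i = W i * T) (J J' : H →L[ℂ] E)
    (hJ : ∀ i a, ContinuousLinearMap.adjoint (W i) (J a) =
      J (ContinuousLinearMap.adjoint (U i) a))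
    (hJ' : ∀ i a, W i (J' a) = J' (U i a)) :
    ∃ c : ℂ, ∀ a a', ⟪J a, T (J' a')⟫_ℂ = c * ⟪a, a'⟫_ℂ := by
  let Q : H →L[ℂ] H := ContinuousLinearMap.adjoint J ∘L T ∘L J'
  have hQ : ∀ a a', ⟪a, Q a'⟫_ℂ = ⟪J a, T (J' a')⟫_ℂ := fun a a' =>
    ContinuousLinearMap.adjoint_inner_right J a (T (J' a'))
  obtain ⟨c, hc⟩ := hU Q fun i => by
    ext a'
    refine ext_inner_left ℂ fun a => ?_
    have h : T (W i (J' a')) = W i (T (J' a')) :=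
      congrArg (fun L : E →L[ℂ] E => L (J' a')) (hT i)
    calc ⟪a, Q (U i a')⟫_ℂ = ⟪J a, W i (T (J' a'))⟫_ℂ := by rw [hQ, ← hJ', h]
      _ = ⟪J (ContinuousLinearMap.adjoint (U i) a), T (J' a')⟫_ℂ := by
        rw [← ContinuousLinearMap.adjoint_inner_left, hJ]
      _ = ⟪a, U i (Q a')⟫_ℂ := by rw [← hQ, ContinuousLinearMap.adjoint_inner_left]
  exact ⟨c, fun a a' => by rw [← hQ, hc, smul_apply, one_apply_eq_self, inner_smul_right]⟩

theorem adjoint_tensorOp_one_right_tensorRight (A : H →L[ℂ] H) (b : K) (a : H) :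
    ContinuousLinearMap.adjoint (tensorOp A (1 : K →L[ℂ] K)) (tensorRight b a) =
      tensorRight b (ContinuousLinearMap.adjoint A a) := by
  rw [adjoint_tensorOp, ContinuousLinearMap.adjoint_one]
  exact tensorOp_elemTensor _ _ a b

theorem adjoint_tensorOp_one_left_tensorLeft (B : K →L[ℂ] K) (a : H) (b : K) :
    ContinuousLinearMap.adjoint (tensorOp (1 : H →L[ℂ] H) B) (tensorLeft a b) =
      tensorLeft a (ContinuousLinearMap.adjoint B b) := by
  rw [adjoint_tensorOp, ContinuousLinearMap.adjoint_one]
  exact tensorOp_elemTensor _ _ a b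

/-- If two families of operators have trivial commutants, then so has the family of their
tensor products. -/
theorem tensor_commutant [Nontrivial H] [Nontrivial K] {ι κ : Type*}
    (U : ι → H →L[ℂ] H) (V : κ → K →L[ℂ] K)
    (hU : ∀ T : H →L[ℂ] H, (∀ i, T * U i = U i * T) → ∃ c : ℂ, T = c • 1)
    (hV : ∀ T : K →L[ℂ] K, (∀ i, T * V i = V i * T) → ∃ c : ℂ, T = c • 1)
    (T : HilbertTensor H K →L[ℂ] HilbertTensor H K)
    (hTU : ∀ i, T * tensorOp (U i) 1 = tensorOp (U i) 1 * T)
    (hTV : ∀ i, T * tensorOp 1 (V i) = tensorOp 1 (V i) * T) : ∃ c : ℂ, T = c • 1 := by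
  have hc : ∀ b b' : K, ∃ c : ℂ, ∀ a a' : H,
      ⟪tensorRight (H := H) b a, T (tensorRight (H := H) b' a')⟫_ℂ = c * ⟪a, a'⟫_ℂ := fun b b' =>
    slice_eq_smul_inner hU (fun i => tensorOp (U i) 1) T hTU (tensorRight b) (tensorRight b')
      (fun i a => adjoint_tensorOp_one_right_tensorRight (U i) b a)
      (fun i a => tensorOp_elemTensor (U i) 1 a b')
  have hd : ∀ a a' : H, ∃ d : ℂ, ∀ b b' : K,
      ⟪tensorLeft (K := K) a b, T (tensorLeft (K := K) a' b')⟫_ℂ = d * ⟪b, b'⟫_ℂ := fun a a' =>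
    slice_eq_smul_inner hV (fun i => tensorOp 1 (V i)) T hTV (tensorLeft a) (tensorLeft a')
      (fun i b => adjoint_tensorOp_one_left_tensorLeft (V i) a b)
      (fun i b => tensorOp_elemTensor 1 (V i) a' b)
  -- Matrix elements of `T` are `c(b, b') ⟪a, a'⟫` and also `d(a, a') ⟪b, b'⟫`. Evaluating both at a
  -- unit vector `a = a' = a₀` gives `c(b, b') = d(a₀, a₀) ⟪b, b'⟫`, so `d(a₀, a₀)` is the required
  -- scalar.
  obtain ⟨a₀, ha₀⟩ := exists_norm_eq H (zero_le_one (α := ℝ))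
  obtain ⟨d, hd⟩ := hd a₀ a₀
  refine ⟨d, ext_elemTensor fun a' b' => eq_of_inner_elemTensor fun a b => ?_⟩
  obtain ⟨c, hc⟩ := hc b b'
  have hcd : c = d * ⟪b, b'⟫_ℂ := by
    have h := (hc a₀ a₀).symm.trans (hd b b')
    rw [inner_self_eq_norm_sq_to_K, ha₀] at h
    simpa using h
  have h := hc a a'
  change ⟪elemTensor a b, T (elemTensor a' b')⟫_ℂ = _ at h
  rw [h, hcd, smul_apply, one_apply_eq_self, inner_smul_right, inner_elemTensor]
  ring

theorem IsProjectiveUnitaryRep.tensor {G G' : Type*} [Group G] [Group G']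
    {U : G → H →L[ℂ] H} {m : G → G → Circle} {V : G' → K →L[ℂ] K} {n : G' → G' → Circle}
    (hU : IsProjectiveUnitaryRep U m) (hV : IsProjectiveUnitaryRep V n) :
    IsProjectiveUnitaryRep (fun p : G × G' => tensorOp (U p.1) (V p.2))
      (fun p q => m p.1 q.1 * n p.2 q.2) where
  unitary p := by
    have h1 := Unitary.mem_iff.1 (hU.unitary p.1)
    have h2 := Unitary.mem_iff.1 (hV.unitary p.2)
    simp only [ContinuousLinearMap.star_eq_adjoint] at h1 h2
    rw [Unitary.mem_iff, ContinuousLinearMap.star_eq_adjoint, adjoint_tensorOp, tensorOp_mul,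
      tensorOp_mul, h1.1, h1.2, h2.1, h2.2, tensorOp_one]
    exact ⟨rfl, rfl⟩
  map_one := by
    change tensorOp (U 1) (V 1) = 1
    rw [hU.map_one, hV.map_one, tensorOp_one]
  map_mul p q := by
    rw [Prod.fst_mul, Prod.snd_mul, hU.map_mul, hV.map_mul, tensorOp_smul_smul, tensorOp_mul,
      Circle.coe_mul]
  mult_one_right p := by simp [hU.mult_one_right, hV.mult_one_right]
  mult_one_left p := by simp [hU.mult_one_left, hV.mult_one_left]
  cocycle p q r := by
    simp only [Prod.fst_mul, Prod.snd_mul]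
    rw [mul_mul_mul_comm, hU.cocycle, hV.cocycle, mul_mul_mul_comm]

instance [Nontrivial H] [Nontrivial K] : Nontrivial (HilbertTensor H K) := by
  obtain ⟨a, ha⟩ := exists_ne (0 : H)
  obtain ⟨b, hb⟩ := exists_ne (0 : K)
  exact ⟨elemTensor a b, 0, by rw [← norm_ne_zero_iff, norm_elemTensor]; positivity⟩

/-- If two projective unitary representations have trivial commutants, then their tensor product is
irreducible and its linear span is an ultraweakly dense operator system. -/
theorem IsProjectiveUnitaryRep.tensor_irreducible_and_dense [Nontrivial H] [Nontrivial K]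
    {G G' : Type*} [Group G] [Group G']
    {U : G → H →L[ℂ] H} {m : G → G → Circle} {V : G' → K →L[ℂ] K} {n : G' → G' → Circle}
    (hU : IsProjectiveUnitaryRep U m) (hV : IsProjectiveUnitaryRep V n)
    (hcU : ∀ T : H →L[ℂ] H, (∀ i, T * U i = U i * T) → ∃ c : ℂ, T = c • 1)
    (hcV : ∀ T : K →L[ℂ] K, (∀ i, T * V i = V i * T) → ∃ c : ℂ, T = c • 1) :
    IsIrreducibleProjectiveRep (fun p : G × G' => tensorOp (U p.1) (V p.2)) ∧
      IsOperatorSystem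
        (Submodule.span ℂ (Set.range fun p : G × G' => tensorOp (U p.1) (V p.2))) ∧
      IsUltraweaklyDense
        (Submodule.span ℂ (Set.range fun p : G × G' => tensorOp (U p.1) (V p.2))) := by
  refine (hU.tensor hV).irreducible_and_dense fun T hT => ?_
  -- The pairs `(i, 1)` and `(1, i)` give the operators `U i ⊗ 1` and `1 ⊗ V i`.
  refine tensor_commutant U V hcU hcV T (fun i => ?_) fun i => ?_
  · simpa [hV.map_one] using hT (i, 1)
  · simpa [hU.map_one] using hT (1, i)

end Tensor


/-! ### Characters of commutative operator algebras. -/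

section Character

open scoped IsMulCommutative in
/-- The characters of a commutative C⋆-algebra separate points: a nonzero element of the star
algebra generated by a self-adjoint set of commuting operators is not annihilated by some character
of a commutative C⋆-algebra containing that set. -/
theorem exists_starAlgHom_apply_ne_zero {A : Type*} [CStarAlgebra A] (s : Set A)
    (hcomm : ∀ a ∈ s, ∀ b ∈ s, a * b = b * a) (hstar : ∀ a ∈ s, star a ∈ s) {a : A}
    (ha : a ∈ StarAlgebra.adjoin ℂ s) (ha0 : a ≠ 0) :
    ∃ (S : StarSubalgebra ℂ A) (hS : StarAlgebra.adjoin ℂ s ≤ S) (χ : S →⋆ₐ[ℂ] ℂ),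
      (∀ b : S, ‖χ b‖ ≤ ‖(b : A)‖) ∧ χ ⟨a, hS ha⟩ ≠ 0 := by
  have hadj := StarAlgebra.isMulCommutative_adjoin ℂ hcomm fun a ha b hb => hcomm _ ha _ (hstar b hb)
  let S := (StarAlgebra.adjoin ℂ s).topologicalClosure
  have hS : StarAlgebra.adjoin ℂ s ≤ S := StarSubalgebra.le_topologicalClosure _
  have hScl : IsClosed (S : Set A) := StarSubalgebra.isClosed_topologicalClosure _
  let : CommCStarAlgebra S :=
    { (inferInstance : CStarAlgebra S) with
      mul_comm := fun x y => ((StarAlgebra.adjoin ℂ s).commRingTopologicalClosure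
        fun x y => mul_comm x y).mul_comm x y }
  let x : S := ⟨a, hS ha⟩
  -- The norm closure of the generated star algebra is a commutative C⋆-algebra, so its Gelfand
  -- transform is injective.
  have hx : gelfandStarTransform S x ≠ 0 := by
    rw [Ne, EmbeddingLike.map_eq_zero_iff]
    exact fun h => ha0 (congrArg Subtype.val h)
  obtain ⟨χ, hχ⟩ := DFunLike.ne_iff.1 hx
  refine ⟨S, hS, (ContinuousMap.evalStarAlgHom ℂ ℂ χ).comp
    (gelfandStarTransform S : S →⋆ₐ[ℂ] C(WeakDual.characterSpace ℂ S, ℂ)), fun b => ?_, hχ⟩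
  exact NonUnitalStarAlgHom.norm_apply_le (A := S) (B := ℂ) _ b

end Character

/-! ### Density of compactly supported continuous functions. -/

section CompactSupport

section Basic

variable {X : Type*} [TopologicalSpace X] [MeasurableSpace X] [BorelSpace X] {μ : Measure X}
  [IsFiniteMeasureOnCompacts μ]

variable (μ) in
/-- A compactly supported continuous function as an element of `L²`. -/
def ccLp (f : X → ℂ) (hf : Continuous f) (hc : HasCompactSupport f) :
    Lp ℂ 2 μ :=
  (hf.memLp_of_hasCompactSupport hc).toLp f

theorem ccLp_ae (f : X → ℂ) (hf : Continuous f)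
    (hc : HasCompactSupport f) : ccLp μ f hf hc =ᵐ[μ] f :=
  MemLp.coeFn_toLp _

theorem inner_ccLp (f g : X → ℂ) (hf : Continuous f)
    (hfc : HasCompactSupport f) (hg : Continuous g) (hgc : HasCompactSupport g) :
    ⟪ccLp μ f hf hfc, ccLp μ g hg hgc⟫_ℂ = ∫ x, starRingEnd ℂ (f x) * g x ∂μ := by
  rw [L2.inner_def]
  refine integral_congr_ae ?_
  filter_upwards [ccLp_ae (μ := μ) f hf hfc, ccLp_ae (μ := μ) g hg hgc] with x h1 h2
  rw [h1, h2, RCLike.inner_apply, mul_comm]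

end Basic

variable {X : Type*} [TopologicalSpace X] [LocallyCompactSpace X] [T2Space X]
  [MeasurableSpace X] [BorelSpace X] {μ : Measure X} [μ.Regular]

/-- Compactly supported continuous functions are dense in `Lᵖ` of a regular measure on a locally
compact Hausdorff space. -/
theorem exists_hasCompactSupport_eLpNorm_sub_le {p : ℝ≥0∞} (hp : p ≠ ∞) {f : X → ℂ}
    (hf : MemLp f p μ) {ε : ℝ≥0∞} (hε : ε ≠ 0) :
    ∃ g : X → ℂ, eLpNorm (f - g) p μ ≤ ε ∧ Continuous g ∧ HasCompactSupport g := by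
  apply hf.induction_dense hp (fun g => Continuous g ∧ HasCompactSupport g) _ _ _ hε
  rotate_left
  · rintro f g ⟨hf, hf'⟩ ⟨hg, hg'⟩
    exact ⟨hf.add hg, hf'.add hg'⟩
  · rintro f ⟨hf, hf'⟩
    exact (hf.memLp_of_hasCompactSupport (p := p) hf').aestronglyMeasurable
  intro c t ht htμ ε hε
  obtain ⟨δ, δpos, hδ⟩ := exists_Lp_half ℂ μ p hε
  obtain ⟨η, ηpos, hη⟩ := exists_eLpNorm_indicator_le (μ := μ) hp c δpos.ne'
  have hη_pos : (0 : ℝ≥0∞) < η := ENNReal.coe_pos.2 ηpos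
  -- A compact `s ⊆ t` nearly fills `t`, and an open `v ⊇ s` barely exceeds `s`. The cutoff is `1`
  -- on `s` and `0` off `v`, so it differs from the indicator of `s` only on `v \ s`.
  obtain ⟨s, st, s_compact, s_closed, μs⟩ :=
    ht.exists_isCompact_isClosed_sdiff_lt htμ.ne hη_pos.ne'
  have hsμ : μ s < ∞ := (measure_mono st).trans_lt htμ
  obtain ⟨v, sv, v_open, -, hv⟩ := s_closed.measurableSet.exists_isOpen_sdiff_lt hsμ.ne hη_pos.ne'
  obtain ⟨g, hgs, hgv, hgc, hg01⟩ := exists_continuous_one_zero_of_isCompact s_compact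
    v_open.isClosed_compl (Set.disjoint_compl_right_iff_subset.2 sv)
  have gcont : Continuous fun x => (g x : ℂ) * c := by fun_prop
  have gsupp : HasCompactSupport fun x => (g x : ℂ) * c :=
    (hgc.comp_left (g := fun r : ℝ => (r : ℂ)) (by simp)).mul_right
  have I1 : eLpNorm ((s.indicator fun _ => c) - t.indicator fun _ => c) p μ ≤ δ := by
    rw [← eLpNorm_neg, neg_sub, ← Set.indicator_sdiff st]
    exact hη _ μs.le
  have I2 : eLpNorm ((fun x => (g x : ℂ) * c) - s.indicator fun _ => c) p μ ≤ δ := by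
    refine (eLpNorm_mono fun x => ?_).trans (hη _ hv.le)
    by_cases hxs : x ∈ s
    · simp [hgs hxs, hxs]
    · by_cases hxv : x ∈ v
      · have := hg01 x
        simp only [Pi.sub_apply, hxs, not_false_eq_true, Set.indicator_of_notMem, sub_zero, norm_mul,
          Complex.norm_real, Real.norm_eq_abs, abs_of_nonneg this.1, Set.mem_sdiff, hxv, and_self,
          Set.indicator_of_mem]
        exact mul_le_of_le_one_left (norm_nonneg _) this.2
      · simp [hgv hxv, hxs]
  refine ⟨_, ?_, gcont, gsupp⟩
  convert! (hδ _ _ (gcont.aestronglyMeasurable.sub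
      (aestronglyMeasurable_const.indicator s_closed.measurableSet))
    ((aestronglyMeasurable_const.indicator s_closed.measurableSet).sub
      (aestronglyMeasurable_const.indicator ht)) I2 I1).le using 2
  simp only [sub_add_sub_cancel]

theorem exists_ccLp_norm_sub_le (φ : Lp ℂ 2 μ) {ε : ℝ} (hε : 0 < ε) :
    ∃ f hf hc, ‖φ - ccLp μ f hf hc‖ ≤ ε := by
  obtain ⟨g, hg, hgc, hgs⟩ := exists_hasCompactSupport_eLpNorm_sub_le (by norm_num) (Lp.memLp φ)
    (ENNReal.ofReal_pos.2 hε).ne'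
  refine ⟨g, hgc, hgs, ?_⟩
  rw [Lp.norm_def]
  refine ENNReal.toReal_le_of_le_ofReal hε.le ?_
  rwa [eLpNorm_congr_ae ((Lp.coeFn_sub _ _).trans
    ((Filter.EventuallyEq.refl _ _).sub (ccLp_ae g hgc hgs)))]

theorem dense_ccLp : Dense {φ : Lp ℂ 2 μ | ∃ f hf hc, φ = ccLp μ f hf hc} := by
  intro φ
  rw [Metric.mem_closure_iff]
  intro ε hε
  obtain ⟨f, hf, hc, h⟩ := exists_ccLp_norm_sub_le φ (half_pos hε)
  exact ⟨_, ⟨f, hf, hc, rfl⟩, by rw [dist_eq_norm]; linarith⟩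

end CompactSupport

/-! ### Translations and their averages. -/

section Translation

variable {X : Type*} [CommGroup X] [TopologicalSpace X] [IsTopologicalGroup X]
  [MeasurableSpace X] [BorelSpace X] (μ : Measure X) [μ.IsHaarMeasure]

theorem transOp_mul (x y : X) : transOp μ x * transOp μ y = transOp μ (x * y) := by
  ext φ : 1
  refine Lp.ext ?_
  have h := (measurePreserving_mul_left μ x⁻¹).quasiMeasurePreserving.ae_eq_comp (transOp_ae μ y φ)
  filter_upwards [transOp_ae μ x (transOp μ y φ), transOp_ae μ (x * y) φ, h] with z h1 h2 h3
  rw [mul_apply_eq_comp, h1, h2]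
  simp only [Function.comp_apply] at h3
  rw [h3, mul_inv_rev, mul_assoc]

theorem transOp_one : transOp μ (1 : X) = 1 := by
  ext φ : 1
  refine Lp.ext ?_
  filter_upwards [transOp_ae μ 1 φ] with z h1
  rw [h1, inv_one, one_mul, one_apply_eq_self]

theorem norm_transOp_apply (x : X) (φ : Lp ℂ 2 μ) : ‖transOp μ x φ‖ = ‖φ‖ :=
  LinearIsometry.norm_map _ _

theorem inner_transOp_transOp (x : X) (φ ψ : Lp ℂ 2 μ) :
    ⟪transOp μ x φ, transOp μ x ψ⟫_ℂ = ⟪φ, ψ⟫_ℂ :=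
  LinearIsometry.inner_map_map _ _ _

theorem adjoint_transOp (x : X) :
    ContinuousLinearMap.adjoint (transOp μ x) = transOp μ x⁻¹ := by
  symm
  rw [ContinuousLinearMap.eq_adjoint_iff]
  intro φ ψ
  rw [← inner_transOp_transOp μ x (transOp μ x⁻¹ φ), ← mul_apply_eq_comp, transOp_mul,
    mul_inv_cancel, transOp_one, one_apply_eq_self]

omit [MeasurableSpace X] [BorelSpace X] in
theorem hasCompactSupport_comp_mul_left {f : X → ℂ} (hc : HasCompactSupport f) (x : X) :
    HasCompactSupport fun y => f (x * y) :=
  hc.comp_homeomorph (Homeomorph.mulLeft x)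

theorem transOp_ccLp (x : X) (f : X → ℂ) (hf : Continuous f) (hc : HasCompactSupport f) :
    transOp μ x (ccLp μ f hf hc) =
      ccLp μ (fun y => f (x⁻¹ * y)) (by fun_prop) (hasCompactSupport_comp_mul_left hc _) := by
  refine Lp.ext ?_
  have h := (measurePreserving_mul_left μ x⁻¹).quasiMeasurePreserving.ae_eq_comp
    (ccLp_ae (μ := μ) f hf hc)
  filter_upwards [transOp_ae μ x (ccLp μ f hf hc), h, ccLp_ae (μ := μ) (fun y => f (x⁻¹ * y))
    (by fun_prop) (hasCompactSupport_comp_mul_left hc _)] with z h1 h2 h3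
  rw [h1, h3]
  exact h2

variable [LocallyCompactSpace X] [μ.Regular]

omit [MeasurableSpace X] [BorelSpace X] [LocallyCompactSpace X] in
theorem continuous_inv_mul_uncurry :
    Continuous (Function.uncurry fun x y : X => x⁻¹ * y) := by
  simp only [Function.uncurry_def]
  fun_prop

theorem continuous_transOp_apply (φ : Lp ℂ 2 μ) : Continuous fun x => transOp μ x φ := by
  refine Continuous.compMeasurePreservingLp (f := fun _ : X => φ)
    (g := fun x : X => (⟨fun y => x⁻¹ * y, by fun_prop⟩ : C(X, X))) continuous_const ?_
    (fun x => measurePreserving_mul_left μ x⁻¹) (by norm_num)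
  exact ContinuousMap.continuous_of_continuous_uncurry _ continuous_inv_mul_uncurry

/-- Translation is continuous in the mean for compactly supported continuous functions. -/
theorem tendsto_integral_norm_translate_sub {f : X → ℂ} (hf : Continuous f)
    (hc : HasCompactSupport f) :
    Filter.Tendsto (fun x : X => ∫ y, ‖f (x⁻¹ * y) - f y‖ ∂μ) (nhds 1) (nhds 0) := by
  have hm : MemLp f 1 μ := hf.memLp_of_hasCompactSupport hc
  have hcont : Continuous fun x : X => Lp.compMeasurePreserving (fun y => x⁻¹ * y)
      (measurePreserving_mul_left μ x⁻¹) (hm.toLp f) :=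
    Continuous.compMeasurePreservingLp (f := fun _ : X => hm.toLp f)
      (g := fun x : X => (⟨fun y => x⁻¹ * y, by fun_prop⟩ : C(X, X))) continuous_const
      (ContinuousMap.continuous_of_continuous_uncurry _ continuous_inv_mul_uncurry)
      (fun x => measurePreserving_mul_left μ x⁻¹) (by norm_num)
  have key : ∀ x : X, ∫ y, ‖f (x⁻¹ * y) - f y‖ ∂μ = ‖Lp.compMeasurePreserving (fun y => x⁻¹ * y)
      (measurePreserving_mul_left μ x⁻¹) (hm.toLp f) - hm.toLp f‖ := by
    intro x
    rw [L1.norm_eq_integral_norm]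
    refine integral_congr_ae ?_
    have h := (measurePreserving_mul_left μ x⁻¹).quasiMeasurePreserving.ae_eq_comp hm.coeFn_toLp
    filter_upwards [Lp.coeFn_sub (Lp.compMeasurePreserving (fun y => x⁻¹ * y)
      (measurePreserving_mul_left μ x⁻¹) (hm.toLp f)) (hm.toLp f), hm.coeFn_toLp,
      Lp.coeFn_compMeasurePreserving (hm.toLp f) (measurePreserving_mul_left μ x⁻¹), h]
      with y h1 h2 h3 h4
    rw [h1, Pi.sub_apply, h2, h3, h4]
    rfl
  simp_rw [key]
  have h1 := ((hcont.sub continuous_const).norm).tendsto' (1 : X) 0 (f := fun x => ‖_ - hm.toLp f‖) (by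
    rw [← key]; simp)
  exact h1

/-- The operator `∫ f(x) U(x) dx` for a compactly supported continuous function `f`. -/
def avgOp (f : X → ℂ) (hf : Continuous f) (hc : HasCompactSupport f) : Lp ℂ 2 μ →L[ℂ] Lp ℂ 2 μ :=
  LinearMap.mkContinuous
    { toFun := fun φ => ∫ x, f x • transOp μ x φ ∂μ
      map_add' := fun φ ψ => by
        simp only [map_add, smul_add]
        exact integral_add
          ((hf.smul (continuous_transOp_apply μ φ)).integrable_of_hasCompactSupport hc.smul_right)
          ((hf.smul (continuous_transOp_apply μ ψ)).integrable_of_hasCompactSupport hc.smul_right)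
      map_smul' := fun c φ => by
        simp only [map_smul, smul_comm _ c, RingHom.id_apply]
        exact integral_smul c _ }
    (∫ x, ‖f x‖ ∂μ) fun φ => by
      refine (norm_integral_le_integral_norm _).trans ?_
      simp only [norm_smul, norm_transOp_apply]
      rw [integral_mul_const]

variable {μ}

theorem integrable_smul_transOp {f : X → ℂ} (hf : Continuous f) (hc : HasCompactSupport f)
    (φ : Lp ℂ 2 μ) : Integrable (fun x => f x • transOp μ x φ) μ :=
  (hf.smul (continuous_transOp_apply μ φ)).integrable_of_hasCompactSupport hc.smul_right

theorem inner_avgOp {f : X → ℂ} (hf : Continuous f) (hc : HasCompactSupport f)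
    (φ ψ : Lp ℂ 2 μ) :
    ⟪ψ, avgOp μ f hf hc φ⟫_ℂ = ∫ x, f x * ⟪ψ, transOp μ x φ⟫_ℂ ∂μ := by
  change ⟪ψ, ∫ x, f x • transOp μ x φ ∂μ⟫_ℂ = _
  rw [← integral_inner (integrable_smul_transOp hf hc φ)]
  simp only [inner_smul_right]

theorem avgOp_mul_transOp {f : X → ℂ} (hf : Continuous f) (hc : HasCompactSupport f) (x : X) :
    avgOp μ f hf hc * transOp μ x = transOp μ x * avgOp μ f hf hc := by
  ext φ : 1
  refine ext_inner_left ℂ fun ψ => ?_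
  rw [mul_apply_eq_comp, mul_apply_eq_comp,
    ← ContinuousLinearMap.adjoint_inner_left (transOp μ x), inner_avgOp, inner_avgOp]
  refine integral_congr_ae (Filter.Eventually.of_forall fun y => ?_)
  simp only
  rw [ContinuousLinearMap.adjoint_inner_left, ← mul_apply_eq_comp, ← mul_apply_eq_comp, transOp_mul,
    transOp_mul, mul_comm x]

/-- Invariance of the Haar measure moves the translation onto `f`. Combined with
`tendsto_integral_norm_translate_sub`, this yields norm continuity of `x ↦ U(x) T` at `1` for an
average `T`, whereas `U` itself is used only as strongly continuous. -/
theorem norm_transOp_mul_avgOp_sub_le {f : X → ℂ} (hf : Continuous f) (hc : HasCompactSupport f)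
    (x : X) :
    ‖transOp μ x * avgOp μ f hf hc - avgOp μ f hf hc‖ ≤ ∫ y, ‖f (x⁻¹ * y) - f y‖ ∂μ := by
  refine ContinuousLinearMap.opNorm_le_bound _ (integral_nonneg fun _ => norm_nonneg _) fun φ => ?_
  have h1 : (transOp μ x * avgOp μ f hf hc - avgOp μ f hf hc) φ =
      ∫ y, (f (x⁻¹ * y) - f y) • transOp μ y φ ∂μ := by
    simp only [sub_smul]
    have hi : Integrable (fun y => f (x⁻¹ * y) • transOp μ y φ) μ :=
      integrable_smul_transOp (f := fun y => f (x⁻¹ * y)) (by fun_prop)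
        (hasCompactSupport_comp_mul_left hc _) φ
    rw [integral_sub hi (integrable_smul_transOp hf hc φ), sub_apply, mul_apply_eq_comp]
    congr 1
    change transOp μ x (∫ y, f y • transOp μ y φ ∂μ) = _
    rw [← ContinuousLinearMap.integral_comp_comm _ (integrable_smul_transOp hf hc φ),
      ← integral_mul_left_eq_self _ x⁻¹]
    refine integral_congr_ae (Filter.Eventually.of_forall fun y => ?_)
    simp only [map_smul]
    rw [← mul_apply_eq_comp, transOp_mul, mul_inv_cancel_left]
  rw [h1, ← integral_mul_const]
  refine (norm_integral_le_integral_norm _).trans_eq ?_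
  simp only [norm_smul, norm_transOp_apply]

/-- The adjoint of `U(x)` is `U(x⁻¹)`, and the Haar measure of an abelian group is invariant under
inversion. -/
theorem adjoint_avgOp {f : X → ℂ} (hf : Continuous f) (hc : HasCompactSupport f)
    (hsymm : ∀ x, f x⁻¹ = starRingEnd ℂ (f x)) :
    ContinuousLinearMap.adjoint (avgOp μ f hf hc) = avgOp μ f hf hc := by
  symm
  rw [ContinuousLinearMap.eq_adjoint_iff]
  intro φ ψ
  rw [← inner_conj_symm, inner_avgOp, inner_avgOp, ← integral_conj, ← integral_inv_eq_self]
  refine integral_congr_ae (Filter.Eventually.of_forall fun x => ?_)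
  simp only [map_mul]
  rw [hsymm, RCLike.conj_conj, inner_conj_symm, ← adjoint_transOp,
    ContinuousLinearMap.adjoint_inner_left]

end Translation


/-! ### Continuous characters separate points. -/

section Separation

variable {X : Type*} [CommGroup X] [TopologicalSpace X] [IsTopologicalGroup X]
  [LocallyCompactSpace X] [T2Space X]

/-- A Urysohn function equal to `1` at `1` and `0` at `x⁻¹` is moved by the translation: the values
at `1` differ, and continuous functions equal almost everywhere for Haar measure are equal. -/
theorem exists_transOp_apply_ne [MeasurableSpace X] [BorelSpace X] (μ : Measure X)
    [μ.IsHaarMeasure] {x : X} (hx : x ≠ 1) : ∃ φ : Lp ℂ 2 μ, transOp μ x φ ≠ φ := by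
  obtain ⟨f, hf1, hfx, hfc, -⟩ := exists_continuous_one_zero_of_isCompact
    (isCompact_singleton (x := (1 : X))) (isClosed_singleton (x := x⁻¹)) (by simpa using hx)
  have hF : Continuous fun y => (f y : ℂ) := by fun_prop
  have hFc : HasCompactSupport fun y => (f y : ℂ) :=
    hfc.comp_left (g := fun r : ℝ => (r : ℂ)) (by simp)
  refine ⟨ccLp μ _ hF hFc, fun h => ?_⟩
  rw [transOp_ccLp] at h
  have hae := ccLp_ae (μ := μ) (fun y => (f (x⁻¹ * y) : ℂ)) (by fun_prop)
    (hasCompactSupport_comp_mul_left hFc x⁻¹)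
  rw [h] at hae
  replace hae := hae.symm.trans (ccLp_ae (μ := μ) _ hF hFc)
  have heq := (Continuous.ae_eq_iff_eq μ (by fun_prop) hF).1 hae
  have h1 := congrFun heq 1
  have e1 : f 1 = 1 := hf1 rfl
  have e2 : f x⁻¹ = 0 := hfx rfl
  simp [e1, e2] at h1

/-- There is a self-adjoint average `T` of translations with `U(x) T ≠ T`. -/
theorem exists_avgOp [MeasurableSpace X] [BorelSpace X] (μ : Measure X)
    [μ.IsHaarMeasure] [μ.Regular] {x : X} (hx : x ≠ 1) :
    ∃ (f : X → ℂ) (hf : Continuous f) (hc : HasCompactSupport f),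
      ContinuousLinearMap.adjoint (avgOp μ f hf hc) = avgOp μ f hf hc ∧
      transOp μ x * avgOp μ f hf hc - avgOp μ f hf hc ≠ 0 := by
  obtain ⟨φ, hφ⟩ := exists_transOp_apply_ne μ hx
  set v := transOp μ x φ - φ with hv
  have hv0 : v ≠ 0 := sub_ne_zero.2 hφ
  have hcont : Continuous fun y => (⟪v, transOp μ y v⟫_ℂ).re :=
    Complex.continuous_re.comp (continuous_const.inner (continuous_transOp_apply μ v))
  have h1 : 0 < (⟪v, transOp μ 1 v⟫_ℂ).re := by
    rw [transOp_one, one_apply_eq_self, inner_self_eq_norm_sq_to_K]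
    norm_cast
    exact pow_pos (norm_pos_iff.2 hv0) 2
  -- If `U(x) T = T`, then `T v = 0`, because `T` commutes with `U(x)`. To contradict this, `k` is
  -- supported where `Re ⟪v, U(y) v⟫ > 0`, which makes `Re ⟪v, T v⟫` positive. The weight `k(y)
  -- k(y⁻¹)` is symmetric, so that `T` is self-adjoint.
  obtain ⟨k, hk1, hk0, hkc, hk01⟩ := exists_continuous_one_zero_of_isCompact
    (isCompact_singleton (x := (1 : X))) (isOpen_lt continuous_const hcont).isClosed_compl
    (by simpa using h1)
  have hF : Continuous fun y => (k y : ℂ) * (k y⁻¹ : ℂ) := by fun_prop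
  have hFc : HasCompactSupport fun y => (k y : ℂ) * (k y⁻¹ : ℂ) :=
    (hkc.comp_left (g := fun r : ℝ => (r : ℂ)) (by simp)).mul_right
  refine ⟨_, hF, hFc, adjoint_avgOp hF hFc fun y => by simp [mul_comm], fun h0 => ?_⟩
  have hTv : avgOp μ _ hF hFc v = 0 := by
    have h2 := congrArg (fun L : Lp ℂ 2 μ →L[ℂ] Lp ℂ 2 μ => L φ) h0
    rw [← avgOp_mul_transOp] at h2
    simpa [hv] using h2
  have h3 := inner_avgOp hF hFc v v
  rw [hTv, inner_zero_right] at h3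
  have hint : Integrable (fun y => (k y : ℂ) * (k y⁻¹ : ℂ) * ⟪v, transOp μ y v⟫_ℂ) μ :=
    (hF.mul (continuous_const.inner (continuous_transOp_apply μ v))).integrable_of_hasCompactSupport
      hFc.mul_right
  have h4 : ∫ y, (k y * k y⁻¹) * (⟪v, transOp μ y v⟫_ℂ).re ∂μ = 0 := by
    have h5 := integral_re hint
    rw [← h3] at h5
    simp only [RCLike.re_eq_complex_re, Complex.zero_re] at h5
    rw [← h5]
    refine integral_congr_ae (Filter.Eventually.of_forall fun y => ?_)
    simp only
    rw [← Complex.ofReal_mul, Complex.re_ofReal_mul]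
  refine absurd h4 (ne_of_gt ?_)
  refine Continuous.integral_pos_of_hasCompactSupport_nonneg_nonzero (x := 1)
    (Continuous.mul (by fun_prop) hcont) hkc.mul_right.mul_right (fun y => ?_) ?_
  · by_cases hy : y ∈ {y | 0 < (⟪v, transOp μ y v⟫_ℂ).re}
    · exact mul_nonneg (mul_nonneg (hk01 _).1 (hk01 _).1) (le_of_lt hy)
    · simp [show k y = 0 from hk0 hy]
  · have e1 : k 1 = 1 := hk1 rfl
    simpa [e1] using h1.ne'

/-- The continuous characters of a locally compact Hausdorff abelian group separate points. -/
theorem exists_pontryaginDual_apply_ne_one {x : X} (hx : x ≠ 1) :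
    ∃ ξ : PontryaginDual X, ξ x ≠ 1 := by
  borelize X
  let μ : Measure X := Measure.haar
  obtain ⟨f, hf, hc, hadj, hne⟩ := exists_avgOp μ hx
  let T := avgOp μ f hf hc
  let s : Set (Lp ℂ 2 μ →L[ℂ] Lp ℂ 2 μ) := insert T (Set.range (transOp μ))
  have hcomm : ∀ a ∈ s, ∀ b ∈ s, a * b = b * a := by
    rintro _ (rfl | ⟨y, rfl⟩) _ (rfl | ⟨z, rfl⟩)
    · rfl
    · exact avgOp_mul_transOp hf hc z
    · exact (avgOp_mul_transOp hf hc y).symm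
    · rw [transOp_mul, transOp_mul, mul_comm]
  have hstar : ∀ a ∈ s, star a ∈ s := by
    rintro _ (rfl | ⟨y, rfl⟩)
    · exact Or.inl hadj
    · exact Or.inr ⟨y⁻¹, (adjoint_transOp μ y).symm⟩
  have hU : ∀ y, transOp μ y ∈ StarAlgebra.adjoin ℂ s := fun y =>
    StarAlgebra.subset_adjoin ℂ s (Or.inr ⟨y, rfl⟩)
  have hT : T ∈ StarAlgebra.adjoin ℂ s := StarAlgebra.subset_adjoin ℂ s (Or.inl rfl)
  obtain ⟨S, hS, χ, hχ, hχx⟩ := exists_starAlgHom_apply_ne_zero s hcomm hstar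
    (sub_mem (mul_mem (hU x) hT) hT) hne
  let ω : X →* ℂ :=
    { toFun := fun y => χ ⟨transOp μ y, hS (hU y)⟩
      map_one' := by
        rw [← map_one χ]
        congr 1
        exact Subtype.ext (transOp_one μ)
      map_mul' := fun y z => by
        rw [← map_mul χ]
        congr 1
        exact Subtype.ext (transOp_mul μ y z).symm }
  -- Continuity of `ω` is read off from `(ω y - 1) τ = χ (U(y) T - T)`, whose right side tends to
  -- zero as `y → 1`. The choice of `χ` makes the value at `x` nonzero, which gives both `τ ≠ 0` and
  -- `ω x ≠ 1`.
  let τ := χ ⟨T, hS hT⟩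
  have hωT : ∀ y, (ω y - 1) * τ =
      χ ⟨transOp μ y * T - T, sub_mem (mul_mem (hS (hU y)) (hS hT)) (hS hT)⟩ := by
    intro y
    rw [sub_mul, one_mul]
    change χ _ * χ _ - χ _ = _
    rw [← map_mul, ← map_sub]
    rfl
  have hωx : (ω x - 1) * τ ≠ 0 := by rw [hωT]; exact hχx
  have hτ : τ ≠ 0 := right_ne_zero_of_mul hωx
  have hle : ∀ y, ‖ω y‖ ≤ 1 := fun y => (hχ _).trans
    (ContinuousLinearMap.opNorm_le_bound _ zero_le_one fun φ => by
      rw [norm_transOp_apply, one_mul])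
  -- Both `‖ω y‖` and `‖ω y⁻¹‖` are at most `1`, and their product is `1`.
  have hnorm : ∀ y, ‖ω y‖ = 1 := fun y => by
    refine le_antisymm (hle y) ?_
    have h : ‖ω y‖ * ‖ω y⁻¹‖ = 1 := by
      rw [← norm_mul, ← map_mul, mul_inv_cancel, map_one, norm_one]
    nlinarith [hle y⁻¹, norm_nonneg (ω y)]
  have hat : Filter.Tendsto ω (nhds 1) (nhds 1) := by
    rw [tendsto_iff_norm_sub_tendsto_zero]
    have h0 : Filter.Tendsto (fun y : X => (∫ z, ‖f (y⁻¹ * z) - f z‖ ∂μ) / ‖τ‖)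
        (nhds 1) (nhds 0) := by
      simpa using (tendsto_integral_norm_translate_sub μ hf hc).div_const ‖τ‖
    refine squeeze_zero (fun _ => norm_nonneg _) (fun y => ?_) h0
    rw [le_div_iff₀ (norm_pos_iff.2 hτ), ← norm_mul, hωT]
    exact (hχ _).trans (norm_transOp_mul_avgOp_sub_le hf hc y)
  let ξ : X →* Circle :=
    { toFun := fun y => ⟨ω y, mem_sphere_zero_iff_norm.2 (hnorm y)⟩
      map_one' := Subtype.ext (map_one ω)
      map_mul' := fun y z => Subtype.ext (map_mul ω y z) }
  have hξ : Continuous ξ := by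
    refine continuous_of_continuousAt_one ξ ?_
    have hind : Topology.IsInducing (fun z : Circle => (z : ℂ)) := ⟨rfl⟩
    rw [ContinuousAt, map_one, hind.tendsto_nhds_iff]
    exact hat
  refine ⟨(⟨ξ, hξ⟩ : X →ₜ* Circle), fun h => hωx ?_⟩
  have h2 : ω x = 1 := congrArg Subtype.val (show ξ x = 1 from h)
  rw [h2, sub_self, zero_mul]

end Separation


/-! ### Stone–Weierstrass approximation with a global norm bound. -/

section StoneWeierstrass

open scoped BoundedContinuousFunction

/-- The radial retraction of `ℂ` onto the closed disc of radius `r`. -/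
def clamp (r : ℝ) (z : ℂ) : ℂ := z * ((r / max r ‖z‖ : ℝ) : ℂ)

theorem continuous_clamp {r : ℝ} (hr : 0 < r) : Continuous (clamp r) := by
  have h : Continuous fun z : ℂ => r / max r ‖z‖ :=
    continuous_const.div (by fun_prop) fun z => (hr.trans_le (le_max_left _ _)).ne'
  exact continuous_id.mul (Complex.continuous_ofReal.comp h)

theorem norm_clamp_le {r : ℝ} (hr : 0 < r) (z : ℂ) : ‖clamp r z‖ ≤ r := by
  have hM : 0 < max r ‖z‖ := hr.trans_le (le_max_left _ _)
  rw [clamp, norm_mul, Complex.norm_real, Real.norm_eq_abs, abs_of_pos (div_pos hr hM),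
    mul_div_assoc', div_le_iff₀ hM, mul_comm]
  exact mul_le_mul_of_nonneg_left (le_max_right _ _) hr.le

theorem norm_clamp_sub_le {r ε : ℝ} (hr : 0 < r) (hε : 0 ≤ ε) {z : ℂ} (hz : ‖z‖ ≤ r + ε) :
    ‖clamp r z - z‖ ≤ ε := by
  have hM : 0 < max r ‖z‖ := hr.trans_le (le_max_left _ _)
  have h1 : clamp r z - z = z * ((r / max r ‖z‖ - 1 : ℝ) : ℂ) := by
    rw [clamp]; push_cast; ring
  have h2 : r / max r ‖z‖ - 1 ≤ 0 := by
    rw [sub_nonpos, div_le_one hM]; exact le_max_left _ _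
  rw [h1, norm_mul, Complex.norm_real, Real.norm_eq_abs, abs_of_nonpos h2]
  have h3 : max r ‖z‖ ≤ r + ε := max_le (by linarith) hz
  have h4 : 0 ≤ -(r / max r ‖z‖ - 1) := by linarith
  calc ‖z‖ * -(r / max r ‖z‖ - 1) ≤ max r ‖z‖ * -(r / max r ‖z‖ - 1) :=
        mul_le_mul_of_nonneg_right (le_max_right _ _) h4
    _ = max r ‖z‖ - r := by field_simp; ring
    _ ≤ ε := by linarith

variable {X : Type*} [TopologicalSpace X]

/-- Evaluation at a point is a continuous star homomorphism, so it commutes with the functional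
calculus. -/
theorem cfc_boundedContinuousFunction_apply {f : ℂ → ℂ} (hf : Continuous f) (p : X →ᵇ ℂ) (x : X) :
    (cfc f p : X →ᵇ ℂ) x = f (p x) := by
  let ev : (X →ᵇ ℂ) →⋆ₐ[ℂ] ℂ :=
    { toFun := fun q => q x
      map_one' := rfl
      map_mul' := fun _ _ => rfl
      map_zero' := rfl
      map_add' := fun _ _ => rfl
      commutes' := fun _ => rfl
      map_star' := fun _ => rfl }
  have hev : Continuous ev := continuous_eval_const x
  have h := StarAlgHomClass.map_cfc ev f p hf.continuousOn hev ⟨mul_comm _ _⟩ ⟨mul_comm _ _⟩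
  have h2 : cfc f (p x) = f (p x) := cfc_algebraMap (A := ℂ) (p x) f
  exact h.trans h2

/-- Stone–Weierstrass with norm control: on a compact set, bounded continuous functions of norm at
most `r` are uniform limits of elements of norm at most `r` of a point-separating closed star
algebra. -/
theorem exists_mem_topologicalClosure_norm_le (A : StarSubalgebra ℂ (X →ᵇ ℂ))
    (hA : ∀ x y : X, x ≠ y → ∃ m ∈ A, m x ≠ m y) {C : Set X} (hC : IsCompact C) (k : X →ᵇ ℂ)
    {r : ℝ} (hr : 0 < r) (hk : ‖k‖ ≤ r) {ε : ℝ} (hε : 0 < ε) :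
    ∃ m ∈ A.topologicalClosure, ‖m‖ ≤ r ∧ ∀ x ∈ C, ‖k x - m x‖ ≤ ε := by
  have : CompactSpace C := isCompact_iff_compactSpace.1 hC
  let ρ : (X →ᵇ ℂ) →⋆ₐ[ℂ] C(C, ℂ) :=
    (ContinuousMap.compStarAlgHom' ℂ ℂ (⟨Subtype.val, continuous_subtype_val⟩ : C(C, X))).comp
      (BoundedContinuousFunction.toContinuousMapStarₐ ℂ)
  have hsep : (A.map ρ).SeparatesPoints := by
    intro x y hxy
    obtain ⟨m, hm, hne⟩ := hA x y fun h => hxy (Subtype.ext h)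
    exact ⟨ρ m, ⟨ρ m, ⟨m, hm, rfl⟩, rfl⟩, hne⟩
  have htop := ContinuousMap.starSubalgebra_topologicalClosure_eq_top_of_separatesPoints _ hsep
  have hmem : ρ k ∈ (A.map ρ).topologicalClosure := htop ▸ StarSubalgebra.mem_top
  obtain ⟨_, ⟨p, hp, rfl⟩, hd⟩ := Metric.mem_closure_iff.1 hmem (ε / 2) (half_pos hε)
  have hpC : ∀ x ∈ C, ‖k x - p x‖ ≤ ε / 2 := fun x hx => by
    rw [← dist_eq_norm]
    exact (ContinuousMap.dist_apply_le_dist (⟨x, hx⟩ : C)).trans hd.le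
  have hcl : IsClosed (A.topologicalClosure : Set (X →ᵇ ℂ)) :=
    StarSubalgebra.isClosed_topologicalClosure _
  -- The approximant `p` is controlled only on `C`. Retracting its values to the disc of radius `r`
  -- stays in the closed algebra by functional calculus and bounds it everywhere. On `C`, where `‖p
  -- x‖ ≤ r + ε / 2`, it costs at most another `ε / 2`.
  refine ⟨cfc (clamp r) p, ?_, ?_, fun x hx => ?_⟩
  · exact cfc_mem (clamp r) (StarSubalgebra.le_topologicalClosure _ hp)
  · rw [BoundedContinuousFunction.norm_le hr.le]
    intro x
    rw [cfc_boundedContinuousFunction_apply (continuous_clamp hr)]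
    exact norm_clamp_le hr _
  · rw [cfc_boundedContinuousFunction_apply (continuous_clamp hr)]
    have h1 : ‖p x‖ ≤ r + ε / 2 := by
      have := norm_sub_norm_le (p x) (k x)
      rw [norm_sub_rev] at this
      linarith [hpC x hx, k.norm_coe_le_norm x]
    have h2 := norm_clamp_sub_le hr (half_pos hε).le h1
    calc ‖k x - clamp r (p x)‖ = ‖(k x - p x) - (clamp r (p x) - p x)‖ := by congr 1; ring
      _ ≤ ‖k x - p x‖ + ‖clamp r (p x) - p x‖ := norm_sub_le _ _
      _ ≤ ε := by linarith [hpC x hx]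

end StoneWeierstrass

/-! ### Multiplication operators and their invariant subspaces. -/

section Multiplication

open scoped BoundedContinuousFunction

variable {X : Type*} [TopologicalSpace X] [MeasurableSpace X] [BorelSpace X] (μ : Measure X)

theorem memLp_boundedContinuous_mul (m : X →ᵇ ℂ) (φ : Lp ℂ 2 μ) :
    MemLp (fun x => m x * φ x) 2 μ :=
  (Lp.memLp φ).of_le_mul (c := ‖m‖)
    (m.continuous.aestronglyMeasurable.mul (Lp.aestronglyMeasurable φ))
    (Filter.Eventually.of_forall fun x => by
      rw [norm_mul]
      exact mul_le_mul_of_nonneg_right (m.norm_coe_le_norm x) (norm_nonneg _))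

/-- Multiplication of `L²` functions by a bounded continuous function. -/
def mulOp (m : X →ᵇ ℂ) : Lp ℂ 2 μ →L[ℂ] Lp ℂ 2 μ :=
  LinearMap.mkContinuous
    { toFun := fun φ => (memLp_boundedContinuous_mul μ m φ).toLp _
      map_add' := fun φ ψ => by
        rw [← MemLp.toLp_add (memLp_boundedContinuous_mul μ m φ)
          (memLp_boundedContinuous_mul μ m ψ)]
        refine MemLp.toLp_congr _ _ ?_
        filter_upwards [Lp.coeFn_add φ ψ] with x hx
        rw [hx, Pi.add_apply, mul_add, Pi.add_apply]
      map_smul' := fun c φ => by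
        rw [RingHom.id_apply, ← MemLp.toLp_const_smul]
        refine MemLp.toLp_congr _ _ ?_
        filter_upwards [Lp.coeFn_smul c φ] with x hx
        rw [hx, Pi.smul_apply, Pi.smul_apply, smul_eq_mul, smul_eq_mul, mul_left_comm] }
    ‖m‖ (fun φ => by
      refine Lp.norm_le_mul_norm_of_ae_le_mul ?_
      filter_upwards [(memLp_boundedContinuous_mul μ m φ).coeFn_toLp] with x hx
      simp only [LinearMap.coe_mk, AddHom.coe_mk]
      rw [hx, norm_mul]
      exact mul_le_mul_of_nonneg_right (m.norm_coe_le_norm x) (norm_nonneg _))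

variable {μ}

theorem mulOp_ae (m : X →ᵇ ℂ) (φ : Lp ℂ 2 μ) : mulOp μ m φ =ᵐ[μ] fun x => m x * φ x :=
  (memLp_boundedContinuous_mul μ m φ).coeFn_toLp

theorem norm_mulOp_apply_le (m : X →ᵇ ℂ) (φ : Lp ℂ 2 μ) : ‖mulOp μ m φ‖ ≤ ‖m‖ * ‖φ‖ := by
  refine Lp.norm_le_mul_norm_of_ae_le_mul ?_
  filter_upwards [mulOp_ae m φ] with x hx
  rw [hx, norm_mul]
  exact mul_le_mul_of_nonneg_right (m.norm_coe_le_norm x) (norm_nonneg _)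

theorem mulOp_add (m n : X →ᵇ ℂ) (φ : Lp ℂ 2 μ) :
    mulOp μ (m + n) φ = mulOp μ m φ + mulOp μ n φ := by
  refine Lp.ext ?_
  filter_upwards [mulOp_ae (m + n) φ, mulOp_ae m φ, mulOp_ae n φ,
    Lp.coeFn_add (mulOp μ m φ) (mulOp μ n φ)] with x h1 h2 h3 h4
  rw [h1, h4, Pi.add_apply, h2, h3, BoundedContinuousFunction.add_apply, add_mul]

theorem mulOp_smul (c : ℂ) (m : X →ᵇ ℂ) (φ : Lp ℂ 2 μ) :
    mulOp μ (c • m) φ = c • mulOp μ m φ := by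
  refine Lp.ext ?_
  filter_upwards [mulOp_ae (c • m) φ, mulOp_ae m φ, Lp.coeFn_smul c (mulOp μ m φ)] with x h1 h2 h3
  rw [h1, h3, Pi.smul_apply, h2, BoundedContinuousFunction.smul_apply, smul_eq_mul, smul_eq_mul,
    mul_assoc]

theorem mulOp_mul (m n : X →ᵇ ℂ) (φ : Lp ℂ 2 μ) :
    mulOp μ (m * n) φ = mulOp μ m (mulOp μ n φ) := by
  refine Lp.ext ?_
  filter_upwards [mulOp_ae (m * n) φ, mulOp_ae n φ, mulOp_ae m (mulOp μ n φ)] with x h1 h2 h3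
  rw [h1, h3, h2, BoundedContinuousFunction.mul_apply, mul_assoc]

theorem mulOp_one (φ : Lp ℂ 2 μ) : mulOp μ 1 φ = φ := by
  refine Lp.ext ?_
  filter_upwards [mulOp_ae 1 φ] with x h1
  rw [h1, BoundedContinuousFunction.coe_one, Pi.one_apply, one_mul]

theorem mulOp_sub (m n : X →ᵇ ℂ) (φ : Lp ℂ 2 μ) :
    mulOp μ (m - n) φ = mulOp μ m φ - mulOp μ n φ := by
  rw [eq_sub_iff_add_eq, ← mulOp_add, sub_add_cancel]

theorem continuous_mulOp_apply (φ : Lp ℂ 2 μ) : Continuous fun m : X →ᵇ ℂ => mulOp μ m φ := by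
  refine (LipschitzWith.of_dist_le_mul (K := ‖φ‖₊) fun m n => ?_).continuous
  rw [dist_eq_norm, dist_eq_norm, ← mulOp_sub, mul_comm, coe_nnnorm]
  exact norm_mulOp_apply_le _ _

theorem inner_mulOp (m : X →ᵇ ℂ) (φ ψ : Lp ℂ 2 μ) :
    ⟪φ, mulOp μ m ψ⟫_ℂ = ⟪mulOp μ (star m) φ, ψ⟫_ℂ := by
  rw [L2.inner_def, L2.inner_def]
  refine integral_congr_ae ?_
  filter_upwards [mulOp_ae m ψ, mulOp_ae (star m) φ] with x h1 h2
  rw [h1, h2, RCLike.inner_apply, RCLike.inner_apply, BoundedContinuousFunction.star_apply, map_mul,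
    RCLike.star_def, RCLike.conj_conj]
  ring

theorem mulOp_ccLp [IsFiniteMeasureOnCompacts μ] (m : X →ᵇ ℂ) (f : X → ℂ) (hf : Continuous f)
    (hc : HasCompactSupport f) :
    mulOp μ m (ccLp μ f hf hc) = ccLp μ (fun x => m x * f x) (by fun_prop) hc.mul_left := by
  refine Lp.ext ?_
  filter_upwards [mulOp_ae m (ccLp μ f hf hc), ccLp_ae (μ := μ) f hf hc,
    ccLp_ae (μ := μ) (fun x => m x * f x) (by fun_prop) hc.mul_left] with x h1 h2 h3
  rw [h1, h2, h3]

/-- A closed subspace of `L²` invariant under multiplication by a point-separating star algebra of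
bounded continuous functions is invariant under multiplication by all bounded continuous
functions. -/
theorem mulOp_mem_of_separates [LocallyCompactSpace X] [T2Space X] [μ.Regular]
    (A : StarSubalgebra ℂ (X →ᵇ ℂ)) (hA : ∀ x y : X, x ≠ y → ∃ m ∈ A, m x ≠ m y)
    (K : Submodule ℂ (Lp ℂ 2 μ)) (hK : IsClosed (K : Set (Lp ℂ 2 μ)))
    (hinv : ∀ m ∈ A, ∀ φ ∈ K, mulOp μ m φ ∈ K) (k : X →ᵇ ℂ) {φ : Lp ℂ 2 μ} (hφ : φ ∈ K) :
    mulOp μ k φ ∈ K := by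
  have hinv' : ∀ m ∈ A.topologicalClosure, mulOp μ m φ ∈ K := fun m hm =>
    closure_minimal (t := (fun m : X →ᵇ ℂ => mulOp μ m φ) ⁻¹' K) (fun m hm => hinv m hm φ hφ)
      (hK.preimage (continuous_mulOp_apply φ)) hm
  refine hK.closure_subset (Metric.mem_closure_iff.2 fun ε hε => ?_)
  let r := ‖k‖ + 1
  have hr : 0 < r := by positivity
  -- With `w` the compactly supported approximation of `φ`, `m` is close to `k` only on the support
  -- of `w`. The remainder `φ - w` is handled by `‖k - m‖ ≤ 2r`, which is why `m` needs a global
  -- norm bound. The two errors are at most `ε / 2` and `ε / 4`.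
  obtain ⟨f, hf, hc, hφf⟩ := exists_ccLp_norm_sub_le φ (ε := ε / (4 * r)) (by positivity)
  let w := ccLp μ f hf hc
  obtain ⟨m, hm, hmr, hkm⟩ := exists_mem_topologicalClosure_norm_le A hA hc.isCompact k hr
    (by simp [r]) (ε := ε / (4 * (‖w‖ + 1))) (by positivity)
  refine ⟨mulOp μ m φ, hinv' m hm, ?_⟩
  rw [dist_eq_norm, ← mulOp_sub]
  have h1 : ‖mulOp μ (k - m) (φ - w)‖ ≤ ε / 2 := by
    calc ‖mulOp μ (k - m) (φ - w)‖ ≤ ‖k - m‖ * ‖φ - w‖ := norm_mulOp_apply_le _ _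
      _ ≤ (2 * r) * (ε / (4 * r)) := by
        refine mul_le_mul ?_ hφf (norm_nonneg _) (by positivity)
        refine (norm_sub_le _ _).trans ?_
        have : ‖k‖ ≤ r := by simp [r]
        linarith
      _ = ε / 2 := by field_simp; ring
  have h2 : ‖mulOp μ (k - m) w‖ ≤ ε / (4 * (‖w‖ + 1)) * ‖w‖ := by
    refine Lp.norm_le_mul_norm_of_ae_le_mul ?_
    filter_upwards [mulOp_ae (k - m) w, ccLp_ae (μ := μ) f hf hc] with x h3 h4
    rw [h3, norm_mul]
    by_cases hx : x ∈ tsupport f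
    · exact mul_le_mul_of_nonneg_right (hkm x hx) (norm_nonneg _)
    · rw [h4, image_eq_zero_of_notMem_tsupport hx]
      simp
  have h3 : ε / (4 * (‖w‖ + 1)) * ‖w‖ ≤ ε / 4 := by
    have : ‖w‖ / (‖w‖ + 1) ≤ 1 := by
      rw [div_le_one (by positivity)]; linarith
    calc ε / (4 * (‖w‖ + 1)) * ‖w‖ = ε / 4 * (‖w‖ / (‖w‖ + 1)) := by field_simp
      _ ≤ ε / 4 * 1 := mul_le_mul_of_nonneg_left this (by positivity)
      _ = ε / 4 := mul_one _
  calc ‖mulOp μ (k - m) φ‖ = ‖mulOp μ (k - m) (φ - w) + mulOp μ (k - m) w‖ := by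
        rw [← map_add, sub_add_cancel]
    _ ≤ ‖mulOp μ (k - m) (φ - w)‖ + ‖mulOp μ (k - m) w‖ := norm_add_le _ _
    _ < ε := by linarith

end Multiplication


/-! ### Characters as bounded functions, and the Weyl multiplier. -/

open scoped BoundedContinuousFunction

theorem hasCompactSupport_star {X : Type*} [TopologicalSpace X] {k : X →ᵇ ℂ} (hk : HasCompactSupport k) :
    HasCompactSupport (star k : X →ᵇ ℂ) :=
  hk.comp_left (g := star) (star_zero _)

section Basic

variable {X : Type*} [CommGroup X] [TopologicalSpace X] (B : LogPairing X)

/-- A continuous character as a bounded continuous function. -/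
def charBcf (ξ : PontryaginDual X) : X →ᵇ ℂ :=
  BoundedContinuousFunction.ofNormedAddCommGroup (fun x => (ξ x : ℂ))
    (continuous_subtype_val.comp (map_continuous ξ)) 1 fun _ => (Circle.norm_coe _).le

theorem star_charBcf (ξ : PontryaginDual X) : star (charBcf ξ) = charBcf ξ⁻¹ := by
  ext x
  change starRingEnd ℂ (ξ x : ℂ) = ((ξ x)⁻¹ : Circle)
  rw [Circle.coe_inv_eq_conj]

theorem LogPairing.one_left (ξ : PontryaginDual X) : B.toFun 1 ξ = 0 := by
  have h := B.map_mul_left 1 1 ξ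
  rw [one_mul] at h
  linarith

theorem LogPairing.one_right (x : X) : B.toFun x 1 = 0 := by
  have h := B.map_mul_right x 1 1
  rw [one_mul] at h
  linarith

/-- The multiplier of the Weyl representation. -/
def weylMultiplier (g h : X × PontryaginDual X) : Circle :=
  Circle.exp ((B.toFun g.1 h.2 - B.toFun h.1 g.2) / 2)

end Basic

/-! ### Rank-one operators from translations and multiplications. -/

section RankOne

variable {X : Type*} [CommGroup X] [TopologicalSpace X] [IsTopologicalGroup X]
  [LocallyCompactSpace X] [T2Space X] [MeasurableSpace X] [BorelSpace X] {μ : Measure X}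
  [μ.IsHaarMeasure] [μ.Regular]

/-- A bounded continuous function with compact support, as a square-integrable function. -/
abbrev bccLp (μ : Measure X) [IsFiniteMeasureOnCompacts μ] (k : X →ᵇ ℂ) (hk : HasCompactSupport k) :
    Lp ℂ 2 μ := ccLp μ k k.continuous hk

-- The operator has kernel `l(y) f(y/z) k(z)`. The condition on `f` removes the middle factor
-- wherever the outer two are nonzero, so the double integral splits into a product.
omit [T2Space X] in
theorem inner_mulOp_avgOp_mulOp_ccLp {f g h : X → ℂ} (hf : Continuous f) (hfc : HasCompactSupport f)
    (hg : Continuous g) (hgc : HasCompactSupport g) (hh : Continuous h) (hhc : HasCompactSupport h)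
    (k l : X →ᵇ ℂ) (hkl : ∀ y z, l y ≠ 0 → k z ≠ 0 → f (y / z) = 1) :
    ⟪ccLp μ g hg hgc, mulOp μ l (avgOp μ f hf hfc (mulOp μ k (ccLp μ h hh hhc)))⟫_ℂ =
      (∫ y, starRingEnd ℂ (g y) * l y ∂μ) * ∫ z, k z * h z ∂μ := by
  rw [inner_mulOp, mulOp_ccLp, mulOp_ccLp, inner_avgOp]
  simp only [transOp_ccLp, inner_ccLp, BoundedContinuousFunction.star_apply, map_mul,
    RCLike.star_def, RCLike.conj_conj]
  conv_lhs => simp only [← integral_const_mul]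
  rw [integral_integral_swap_of_hasCompactSupport]
  · rw [← integral_mul_const]
    refine integral_congr_ae (Filter.Eventually.of_forall fun y => ?_)
    simp only
    -- Substitution `x = y / z` in the inner integral, turning `x⁻¹ y` into `z`.
    rw [← integral_const_mul, ← integral_div_left_eq_self _ μ y]
    refine integral_congr_ae (Filter.Eventually.of_forall fun z => ?_)
    simp only [inv_div, div_mul_cancel]
    by_cases hl : l y = 0
    · simp [hl]
    by_cases hk : k z = 0
    · simp [hk]
    rw [hkl y z hl hk]
    ring
  · simp only [Function.uncurry_def]
    fun_prop
  · refine HasCompactSupport.intro (hfc.isCompact.prod hgc.isCompact) ?_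
    rintro ⟨x, y⟩ hxy
    simp only [Function.uncurry_apply_pair]
    by_cases hx : x ∈ tsupport f
    · have hy : y ∉ tsupport g := fun hy => hxy ⟨hx, hy⟩
      simp [image_eq_zero_of_notMem_tsupport hy]
    · simp [image_eq_zero_of_notMem_tsupport hx]

/-- Cutting a translation average off by compactly supported functions gives a rank-one
operator. -/
theorem mulOp_avgOp_mulOp {f : X → ℂ} (hf : Continuous f) (hfc : HasCompactSupport f)
    (k l : X →ᵇ ℂ) (hk : HasCompactSupport k) (hl : HasCompactSupport l)
    (hkl : ∀ y z, l y ≠ 0 → k z ≠ 0 → f (y / z) = 1) (φ : Lp ℂ 2 μ) :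
    mulOp μ l (avgOp μ f hf hfc (mulOp μ k φ)) =
      ⟪bccLp μ (star k) (hasCompactSupport_star hk), φ⟫_ℂ • bccLp μ l hl := by
  refine dense_ccLp.induction (P := fun φ => mulOp μ l (avgOp μ f hf hfc (mulOp μ k φ)) =
      ⟪bccLp μ (star k) (hasCompactSupport_star hk), φ⟫_ℂ • bccLp μ l hl) ?_
    (isClosed_eq (by fun_prop) (by fun_prop)) φ
  rintro _ ⟨h, hh, hhc, rfl⟩
  refine ext_inner_left ℂ fun ψ => ?_
  refine dense_ccLp.induction (P := fun ψ =>
    ⟪ψ, mulOp μ l (avgOp μ f hf hfc (mulOp μ k (ccLp μ h hh hhc)))⟫_ℂ =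
      ⟪ψ, ⟪bccLp μ (star k) (hasCompactSupport_star hk), ccLp μ h hh hhc⟫_ℂ • bccLp μ l hl⟫_ℂ) ?_
    (isClosed_eq (by fun_prop) (by fun_prop)) ψ
  rintro _ ⟨g, hg, hgc, rfl⟩
  rw [inner_mulOp_avgOp_mulOp_ccLp hf hfc hg hgc hh hhc k l hkl, inner_smul_right, inner_ccLp,
    inner_ccLp, mul_comm]
  congr 2
  ext z
  simp

end RankOne

/-! ### Triviality of subspaces invariant under translations and modulations. -/

section Irreducible

variable {X : Type*} [CommGroup X] [TopologicalSpace X] [IsTopologicalGroup X]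
  [LocallyCompactSpace X] [T2Space X] [MeasurableSpace X] [BorelSpace X] {μ : Measure X}
  [μ.IsHaarMeasure] [μ.Regular]

omit [LocallyCompactSpace X] [T2Space X] [μ.Regular] in
theorem mulOp_charBcf (ξ : PontryaginDual X) (φ : Lp ℂ 2 μ) :
    mulOp μ (charBcf ξ) φ = modOp μ ξ φ := by
  refine Lp.ext ?_
  filter_upwards [mulOp_ae (charBcf ξ) φ, modOp_ae μ ξ φ] with x h1 h2
  rw [h1, h2]
  rfl

/-- A closed subspace of `L²` invariant under modulations is invariant under multiplication by
bounded continuous functions. -/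
theorem mulOp_mem_of_modOp (K : Submodule ℂ (Lp ℂ 2 μ)) (hK : IsClosed (K : Set (Lp ℂ 2 μ)))
    (hV : ∀ ξ, ∀ φ ∈ K, modOp μ ξ φ ∈ K) (k : X →ᵇ ℂ) {φ : Lp ℂ 2 μ} (hφ : φ ∈ K) :
    mulOp μ k φ ∈ K := by
  let s : Set (X →ᵇ ℂ) := Set.range charBcf
  refine mulOp_mem_of_separates (StarAlgebra.adjoin ℂ s) (fun x y hxy => ?_) K hK ?_ k hφ
  · obtain ⟨ξ, hξ⟩ := exists_pontryaginDual_apply_ne_one (x := x * y⁻¹)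
      (by rwa [Ne, mul_inv_eq_one])
    refine ⟨charBcf ξ, StarAlgebra.subset_adjoin ℂ s ⟨ξ, rfl⟩, fun h => hξ ?_⟩
    have h1 : ξ x = ξ y := Circle.ext h
    rw [map_mul, map_inv, h1, mul_inv_cancel]
  · intro m hm
    -- Invariance under `m` does not by itself yield invariance under `star m`, so the induction
    -- carries both.
    have h : (∀ φ ∈ K, mulOp μ m φ ∈ K) ∧ ∀ φ ∈ K, mulOp μ (star m) φ ∈ K := by
      induction hm using StarAlgebra.adjoin_induction with
      | mem m hm =>
        obtain ⟨ξ, rfl⟩ := hm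
        refine ⟨fun φ hφ => ?_, fun φ hφ => ?_⟩
        · rw [mulOp_charBcf]; exact hV ξ φ hφ
        · rw [star_charBcf, mulOp_charBcf]; exact hV _ φ hφ
      | algebraMap c =>
        rw [← algebraMap_star_comm, Algebra.algebraMap_eq_smul_one, Algebra.algebraMap_eq_smul_one]
        simp only [mulOp_smul, mulOp_one]
        exact ⟨fun φ hφ => K.smul_mem _ hφ, fun φ hφ => K.smul_mem _ hφ⟩
      | add m n _ _ hm hn =>
        rw [star_add]
        simp only [mulOp_add]
        exact ⟨fun φ hφ => K.add_mem (hm.1 φ hφ) (hn.1 φ hφ),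
          fun φ hφ => K.add_mem (hm.2 φ hφ) (hn.2 φ hφ)⟩
      | mul m n _ _ hm hn =>
        rw [star_mul]
        simp only [mulOp_mul]
        exact ⟨fun φ hφ => hm.1 _ (hn.1 φ hφ), fun φ hφ => hn.2 _ (hm.2 φ hφ)⟩
      | star m _ hm =>
        rw [star_star]
        exact ⟨hm.2, hm.1⟩
    exact h.1

omit [T2Space X] in
/-- A closed subspace of `L²` invariant under translations is invariant under their averages. -/
theorem avgOp_mem (K : Submodule ℂ (Lp ℂ 2 μ)) (hK : IsClosed (K : Set (Lp ℂ 2 μ)))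
    (hU : ∀ x, ∀ φ ∈ K, transOp μ x φ ∈ K) {f : X → ℂ} (hf : Continuous f)
    (hfc : HasCompactSupport f) {φ : Lp ℂ 2 μ} (hφ : φ ∈ K) : avgOp μ f hf hfc φ ∈ K := by
  have : CompleteSpace K := hK.completeSpace_coe
  -- Tested against a vector orthogonal to `K`, the integrand defining the average vanishes
  -- identically.
  rw [← K.orthogonal_orthogonal, Submodule.mem_orthogonal]
  intro ψ hψ
  rw [inner_avgOp]
  simp [Submodule.inner_left_of_mem_orthogonal (hU _ φ hφ) hψ]

/-- A closed subspace of `L²` invariant under all translations and modulations is trivial. -/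
theorem eq_bot_or_eq_top_of_transOp_modOp (K : Submodule ℂ (Lp ℂ 2 μ))
    (hK : IsClosed (K : Set (Lp ℂ 2 μ))) (hU : ∀ x, ∀ φ ∈ K, transOp μ x φ ∈ K)
    (hV : ∀ ξ, ∀ φ ∈ K, modOp μ ξ φ ∈ K) : K = ⊥ ∨ K = ⊤ := by
  rw [or_iff_not_imp_left]
  intro hne
  obtain ⟨φ, hφ, hφ0⟩ := K.exists_mem_ne_zero_of_ne_bot hne
  have toBcf : ∀ f : X → ℂ, Continuous f → HasCompactSupport f → ∃ k : X →ᵇ ℂ, (k : X → ℂ) = f := by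
    intro f hf hc
    obtain ⟨C, hC⟩ := hc.exists_bound_of_continuous hf
    exact ⟨BoundedContinuousFunction.ofNormedAddCommGroup f hf C hC, rfl⟩
  obtain ⟨k, hk, hkφ⟩ : ∃ (k : X →ᵇ ℂ) (hk : HasCompactSupport k), ⟪bccLp μ k hk, φ⟫_ℂ ≠ 0 := by
    by_contra! hcon
    refine hφ0 (inner_self_eq_zero (𝕜 := ℂ).1 ?_)
    refine dense_ccLp.induction (P := fun ψ => ⟪ψ, φ⟫_ℂ = 0) ?_
      (isClosed_eq (by fun_prop) (by fun_prop)) φ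
    rintro _ ⟨f, hf, hc, rfl⟩
    obtain ⟨k, rfl⟩ := toBcf f hf hc
    exact hcon k hc
  have hmem : ∀ (l : X →ᵇ ℂ) (hl : HasCompactSupport l), bccLp μ l hl ∈ K := by
    intro l hl
    -- The function `f` equals `1` on the compact set of quotients `y / z` with `y` in the support
    -- of `l` and `z` in that of `k`. The resulting rank-one operator maps `φ` to `⟪k, φ⟫ l`, and
    -- the coefficient is nonzero by the choice of `k`.
    obtain ⟨f, hf1, -, hfc, -⟩ := exists_continuous_one_zero_of_isCompact
      ((hl.isCompact.prod hk.isCompact).image continuous_div') (isClosed_empty (X := X)) (Set.disjoint_empty _)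
    have hF : Continuous fun y => (f y : ℂ) := by fun_prop
    have hFc : HasCompactSupport fun y => (f y : ℂ) :=
      hfc.comp_left (g := fun r : ℝ => (r : ℂ)) (by simp)
    have h := mulOp_avgOp_mulOp (μ := μ) hF hFc (star k) l (hasCompactSupport_star hk) hl
      (fun y z hy hz => by
        have hz' : k z ≠ 0 := fun h => hz (by simp [h])
        have : f (y / z) = 1 := hf1 ⟨(y, z), ⟨subset_tsupport _ hy, subset_tsupport _ hz'⟩, rfl⟩
        simp [this]) φ
    simp only [star_star] at h
    have h2 := mulOp_mem_of_modOp K hK hV l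
      (avgOp_mem K hK hU hF hFc (mulOp_mem_of_modOp K hK hV (star k) hφ))
    rw [h] at h2
    simpa [smul_smul, inv_mul_cancel₀ hkφ] using K.smul_mem (⟪bccLp μ k hk, φ⟫_ℂ)⁻¹ h2
  rw [Submodule.eq_top_iff']
  intro ψ
  refine hK.closure_subset (closure_mono ?_ (dense_ccLp ψ))
  rintro _ ⟨f, hf, hc, rfl⟩
  obtain ⟨l, rfl⟩ := toBcf f hf hc
  exact hmem l hc

end Irreducible

/-! ### The Weyl representation and its commutant. -/

section Weyl

variable {X : Type*} [CommGroup X] [TopologicalSpace X] [IsTopologicalGroup X]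
  [MeasurableSpace X] [BorelSpace X] (μ : Measure X) [μ.IsHaarMeasure] (B : LogPairing X)

theorem modOp_mul (ξ υ : PontryaginDual X) : modOp μ ξ * modOp μ υ = modOp μ (ξ * υ) := by
  ext φ : 1
  refine Lp.ext ?_
  filter_upwards [modOp_ae μ ξ (modOp μ υ φ), modOp_ae μ υ φ, modOp_ae μ (ξ * υ) φ] with x h1 h2 h3
  rw [mul_apply_eq_comp, h1, h2, h3, ← mul_assoc]
  rfl

theorem modOp_one : modOp μ (1 : PontryaginDual X) = 1 := by
  ext φ : 1
  refine Lp.ext ?_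
  filter_upwards [modOp_ae μ 1 φ] with x h1
  rw [h1, one_apply_eq_self]
  change ((1 : Circle) : ℂ) * φ x = φ x
  rw [Circle.coe_one, one_mul]

theorem adjoint_modOp (ξ : PontryaginDual X) :
    ContinuousLinearMap.adjoint (modOp μ ξ) = modOp μ ξ⁻¹ := by
  symm
  rw [ContinuousLinearMap.eq_adjoint_iff]
  intro φ ψ
  rw [← mulOp_charBcf, ← mulOp_charBcf, inner_mulOp, star_charBcf]

/-- The canonical commutation relation between translations and modulations. -/
theorem modOp_mul_transOp (ξ : PontryaginDual X) (x : X) :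
    modOp μ ξ * transOp μ x = (ξ x : ℂ) • (transOp μ x * modOp μ ξ) := by
  ext φ : 1
  refine Lp.ext ?_
  have h := (measurePreserving_mul_left μ x⁻¹).quasiMeasurePreserving.ae_eq_comp (modOp_ae μ ξ φ)
  filter_upwards [modOp_ae μ ξ (transOp μ x φ), transOp_ae μ x φ, transOp_ae μ x (modOp μ ξ φ), h,
    Lp.coeFn_smul (ξ x : ℂ) (transOp μ x (modOp μ ξ φ))] with y h1 h2 h3 h4 h5
  simp only [Function.comp_apply] at h4
  rw [mul_apply_eq_comp, smul_apply, mul_apply_eq_comp, h1, h2, h5, Pi.smul_apply, h3, h4,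
    smul_eq_mul, ← mul_assoc, ← Circle.coe_mul, ← map_mul, mul_inv_cancel_left]

theorem exp_half_eq_circle (t : ℝ) : Complex.exp (Complex.I / 2 * (t : ℂ)) = Circle.exp (t / 2) := by
  rw [Circle.coe_exp]
  congr 1
  push_cast
  ring

theorem weyl_eq (g : X × PontryaginDual X) :
    weyl μ B g = (Circle.exp (B.toFun g.1 g.2 / 2) : ℂ) • (transOp μ g.1 * modOp μ g.2) := by
  rw [weyl, exp_half_eq_circle]
  rfl

/-- Moving `V(ξ)` past `U(x')` costs the phase `(x'|ξ)`, while the half-phase of the product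
contributes `((x|ξ') + (x'|ξ)) / 2`. Their difference is the exponent of the multiplier. It is
additive in each argument, hence the cocycle identity. -/
theorem weyl_projective : IsProjectiveUnitaryRep (weyl μ B) (weylMultiplier B) where
  unitary g := by
    have hU : transOp μ g.1 ∈ unitary (Lp ℂ 2 μ →L[ℂ] Lp ℂ 2 μ) := by
      rw [Unitary.mem_iff, ContinuousLinearMap.star_eq_adjoint, adjoint_transOp, transOp_mul,
        transOp_mul, inv_mul_cancel, mul_inv_cancel, transOp_one]
      exact ⟨rfl, rfl⟩
    have hV : modOp μ g.2 ∈ unitary (Lp ℂ 2 μ →L[ℂ] Lp ℂ 2 μ) := by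
      rw [Unitary.mem_iff, ContinuousLinearMap.star_eq_adjoint, adjoint_modOp, modOp_mul,
        modOp_mul, inv_mul_cancel, mul_inv_cancel, modOp_one]
      exact ⟨rfl, rfl⟩
    have hUV := mul_mem hU hV
    rw [Unitary.mem_iff] at hUV ⊢
    rw [weyl_eq, star_smul, smul_mul_smul_comm, smul_mul_smul_comm, hUV.1, hUV.2, RCLike.star_def,
      ← Circle.coe_inv_eq_conj, ← Circle.coe_mul, ← Circle.coe_mul, inv_mul_cancel, mul_inv_cancel,
      Circle.coe_one, one_smul]
    exact ⟨rfl, rfl⟩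
  map_one := by
    rw [weyl_eq, Prod.fst_one, Prod.snd_one, B.one_left, zero_div, Circle.exp_zero, Circle.coe_one,
      one_smul, transOp_one, modOp_one, one_mul]
  map_mul g h := by
    have hUV : transOp μ g.1 * modOp μ g.2 * (transOp μ h.1 * modOp μ h.2) =
        (Circle.exp (B.toFun h.1 g.2) : ℂ) • (transOp μ (g.1 * h.1) * modOp μ (g.2 * h.2)) := by
      rw [← transOp_mul, ← modOp_mul, ← B.pairing_eq, mul_assoc, ← mul_assoc (modOp μ g.2),
        modOp_mul_transOp, smul_mul_assoc, mul_smul_comm]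
      simp only [mul_assoc]
    rw [weyl_eq, weyl_eq μ B g, weyl_eq μ B h, smul_mul_smul_comm, hUV, smul_smul, smul_smul,
      Prod.fst_mul, Prod.snd_mul, weylMultiplier]
    congr 1
    rw [← Circle.coe_mul, ← Circle.coe_mul, ← Circle.coe_mul, ← Circle.exp_add, ← Circle.exp_add,
      ← Circle.exp_add, B.map_mul_left, B.map_mul_right, B.map_mul_right]
    congr 2
    ring
  mult_one_right g := by
    simp [weylMultiplier, B.one_left, B.one_right]
  mult_one_left g := by
    simp [weylMultiplier, B.one_left, B.one_right]
  cocycle g h k := by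
    simp only [weylMultiplier, Prod.fst_mul, Prod.snd_mul, B.map_mul_left, B.map_mul_right]
    rw [← Circle.exp_add, ← Circle.exp_add]
    congr 1
    ring

theorem weyl_prod_one (x : X) : weyl μ B (x, 1) = transOp μ x := by
  rw [weyl_eq, B.one_right, zero_div, Circle.exp_zero, Circle.coe_one, one_smul, modOp_one, mul_one]

theorem weyl_one_prod (ξ : PontryaginDual X) : weyl μ B (1, ξ) = modOp μ ξ := by
  rw [weyl_eq, B.one_left, zero_div, Circle.exp_zero, Circle.coe_one, one_smul, transOp_one,
    one_mul]

variable [LocallyCompactSpace X] [T2Space X]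

omit [T2Space X] in
theorem nontrivial_L2 : Nontrivial (Lp ℂ 2 μ) := by
  obtain ⟨f, hf1, -, hfc, -⟩ := exists_continuous_one_zero_of_isCompact
    (isCompact_singleton (x := (1 : X))) (isClosed_empty (X := X)) (Set.disjoint_empty _)
  have hF : Continuous fun y => (f y : ℂ) := by fun_prop
  have hFc : HasCompactSupport fun y => (f y : ℂ) :=
    hfc.comp_left (g := fun r : ℝ => (r : ℂ)) (by simp)
  refine ⟨ccLp μ _ hF hFc, 0, fun h => ?_⟩
  have hae := ccLp_ae (μ := μ) _ hF hFc
  rw [h] at hae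
  have h0 := (Continuous.ae_eq_iff_eq μ hF continuous_const (g := fun _ => (0 : ℂ))).1
    (hae.symm.trans (Lp.coeFn_zero _ _ _))
  have e1 : f 1 = 1 := hf1 rfl
  simpa [e1] using congrFun h0 1

variable [μ.Regular]

theorem weyl_commutant (T : Lp ℂ 2 μ →L[ℂ] Lp ℂ 2 μ)
    (hT : ∀ g, T * weyl μ B g = weyl μ B g * T) : ∃ c : ℂ, T = c • 1 := by
  refine (weyl_projective μ B).exists_smul_one_of_commute (fun K hK hinv => ?_) T hT
  refine eq_bot_or_eq_top_of_transOp_modOp K hK (fun x φ hφ => ?_) fun ξ φ hφ => ?_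
  · rw [← weyl_prod_one μ B]; exact hinv _ φ hφ
  · rw [← weyl_one_prod μ B]; exact hinv _ φ hφ

end Weyl

end WeylIrr

end

theorem proposition4p1 {X : Type*} [CommGroup X] [TopologicalSpace X] [IsTopologicalGroup X]
    [LocallyCompactSpace X] [T2Space X] [MeasurableSpace X] [BorelSpace X]
    (B : WeylIrr.LogPairing X)
    (μ : MeasureTheory.Measure X) [μ.IsHaarMeasure] [μ.Regular] :
    (WeylIrr.IsIrreducibleProjectiveRep (WeylIrr.weyl μ B) ∧
      WeylIrr.IsOperatorSystem (Submodule.span ℂ (Set.range (WeylIrr.weyl μ B))) ∧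
      WeylIrr.IsUltraweaklyDense
        (Submodule.span ℂ (Set.range (WeylIrr.weyl μ B)))) ∧
    (WeylIrr.IsIrreducibleProjectiveRep (WeylIrr.weylTensor μ B) ∧
      WeylIrr.IsOperatorSystem (Submodule.span ℂ (Set.range (WeylIrr.weylTensor μ B))) ∧
      WeylIrr.IsUltraweaklyDense
        (Submodule.span ℂ (Set.range (WeylIrr.weylTensor μ B)))) := by
  have := WeylIrr.nontrivial_L2 μ
  exact ⟨(WeylIrr.weyl_projective μ B).irreducible_and_dense (WeylIrr.weyl_commutant μ B),
    (WeylIrr.weyl_projective μ B).tensor_irreducible_and_dense (WeylIrr.weyl_projective μ B)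
      (WeylIrr.weyl_commutant μ B) (WeylIrr.weyl_commutant μ B)⟩
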